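/- Let $\mathcal{E}$ (the metatheory) be a regular locally cartesian closed category with an initial object and a natural number object; all constructions below are made internally in $\mathcal{E}$. Let $\square$ be an internal category of cubes in $\mathcal{E}$: an internal category with finite products and an object $I$ such that every object is isomorphic to a power $I^n$, $n\in\mathbb{N}$, together with two global sections $0,1$ of $I$. A cubical set is an internal presheaf on $\square$, $\mathbf{y}I$ is the representable of $I$, and $\Delta$ is the constant presheaf functor from $\mathcal{E}$ to cubical sets. Fix any notion of Kan fibration of cubical sets with the following properties: fibrations are stable under pullback along arbitrary maps, composition, and dependent products along fibrations; every map $\Delta(u)$ is a fibration; and for every cubical set $A$ and every point $d : 1 \to \mathbf{y}I$ (in the internal sense: $d$ may depend on a parameter from an object $T$ of $\mathcal{E}$ with $A$ lying over $\Delta(T)$), the map $d\times A : A \to \mathbf{y}I\times A$ has the left lifting property against all fibrations. For a map $f : X\to Y$, in $\mathcal{E}$ or in cubical sets, let $\neg f : \neg X \to Y$ be its negation in the slice over $Y$ (the local exponential $\bot^X$), and call $f$ $\neg\neg$-stable if there is a map $\neg\neg X\to X$ over $Y$. A map $f : X\to Y$ of cubical sets is an h-proposition if it is a fibration and $\operatorname{Path}_Y(X)\to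 X\times_Y X$ has a section, where $\operatorname{Path}_Y(X) = Y\times_{Y^{\mathbf{y}I}}X^{\mathbf{y}I}$. Suppose that $m : 1\to\Omega_{\neg\neg}$ classifies the $\neg\neg$-stable propositions of $\mathcal{E}$: it is a monomorphism, every monomorphism of $\mathcal{E}$ is a pullback of $m$ along at most one map, and the pullbacks of $m$ are exactly the $\neg\neg$-stable monomorphisms of $\mathcal{E}$. Then $\Delta(m) : \Delta(1)\to\Delta(\Omega_{\neg\neg})$ is a homotopy classifier for all $\neg\neg$-stable h-propositions in cubical sets. That is, $\Delta(m)$ is itself a $\neg\neg$-stable h-proposition, and for every $\neg\neg$-stable h-proposition $f : X\to Y$ there is a map $\chi : Y\to\Delta(\Omega_{\neg\neg})$, unique up to homotopy, such that $f$ is a homotopy pullback of $\Delta(m)$ along $\chi$, i.e. $f$ is homotopy equivalent over $Y$ to the pullback of $\Delta(m)$ along $\chi$. -/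

import Mathlib

open CategoryTheory CategoryTheory.Limits

universe v u

noncomputable section

namespace CubicalModel

/-! ## Dependent products, negation, and classifiers in a category -/

section Generic

variable {C : Type u} [Category.{v} C]

/-- `π : P ⟶ Z` is the dependent product `Π_g f` of `f : X ⟶ Y` along `g : Y ⟶ Z`: maps `a ⟶ π` over
`Z` correspond, by evaluation, to maps `g^* a ⟶ f` over `Y`. -/
def IsDependentProduct {X Y Z P : C} (f : X ⟶ Y) (g : Y ⟶ Z) (π : P ⟶ Z) : Prop :=
  ∃ (Q : C) (q₁ : Q ⟶ P) (q₂ : Q ⟶ Y) (ev : Q ⟶ X),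
    IsPullback q₁ q₂ π g ∧ ev ≫ f = q₂ ∧
    ∀ {A B : C} (a : A ⟶ Z) (k : B ⟶ A) (b : B ⟶ Y), IsPullback k b a g →
      ∀ h : B ⟶ X, h ≫ f = b →
        ∃! t : A ⟶ P, t ≫ π = a ∧
          ∀ l : B ⟶ Q, l ≫ q₁ = k ≫ t → l ≫ q₂ = b → l ≫ ev = h

/-- `n : N ⟶ Y` is the negation of `f : X ⟶ Y` in the slice over `Y`, that is, the local exponential
`⊥ ^ f = Π_f (f^* ⊥)`, where `f^* ⊥` is the map from the initial object to `X`. -/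
def IsNegation {X Y N : C} (f : X ⟶ Y) (n : N ⟶ Y) : Prop :=
  ∃ (Z : C) (hZ : IsInitial Z), IsDependentProduct (hZ.to X) f n

/-- `f` is `¬¬`-stable: there is a map `¬¬f ⟶ f` over the codomain of `f`. -/
def NegNegStable {X Y : C} (f : X ⟶ Y) : Prop :=
  ∃ (N NN : C) (n : N ⟶ Y) (nn : NN ⟶ Y),
    IsNegation f n ∧ IsNegation n nn ∧ ∃ s : NN ⟶ X, s ≫ f = nn

/-- A `¬¬`-stable proposition of the ambient extensional type theory (in context `Y`). -/
def NegNegStableProp : MorphismProperty C :=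
  fun _ _ f => Mono f ∧ NegNegStable f

/-- A monomorphism is extensional if each monomorphism has at most one classifying map to it. -/
def Extensional {Q P : C} (m : Q ⟶ P) : Prop :=
  Mono m ∧ ∀ {X Y : C} (f : X ⟶ Y), Mono f → ∀ χ χ' : Y ⟶ P,
    (∃ t : X ⟶ Q, IsPullback t f m χ) → (∃ t : X ⟶ Q, IsPullback t f m χ') → χ = χ'

/-- `m` is the classifier of the class `W` of monomorphisms: it is extensional, and `W` consists of
the pullbacks of `m`. -/
def IsClassifier (W : MorphismProperty C) {Q P : C} (m : Q ⟶ P) : Prop :=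
  Extensional m ∧ ∀ {X Y : C} (f : X ⟶ Y), W f ↔ ∃ (χ : Y ⟶ P) (t : X ⟶ Q), IsPullback t f m χ

variable (C) in
/-- Local cartesian closure: each pullback functor between slices has a right adjoint. -/
class LocallyCartesianClosed [HasPullbacks C] : Prop where
  isLeftAdjoint {X Y : C} (f : X ⟶ Y) : (Over.pullback f).IsLeftAdjoint

variable (C) in
/-- A natural number object. -/
structure NaturalNumbersObject [HasTerminal C] where
  N : C
  zero : ⊤_ C ⟶ N
  succ : N ⟶ N
  existsUnique_rec : ∀ {A : C} (a : ⊤_ C ⟶ A) (s : A ⟶ A),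
    ∃! r : N ⟶ A, zero ≫ r = a ∧ succ ≫ r = r ≫ s

end Generic

/-! ## Internal categories and internal presheaves

Structure maps defined on objects of composable pairs are given on generalized elements, naturally in
the stage `T` of definition; by the Yoneda lemma this is the same as giving a map out of the pullback
that represents such pairs. -/

/-- An internal category in `E`; `comp f g` is "first `f`, then `g`". -/
structure InternalCategory (E : Type u) [Category.{v} E] where
  Ob : E
  Mor : E
  src : Mor ⟶ Ob
  tgt : Mor ⟶ Ob
  ident : Ob ⟶ Mor
  comp : ∀ {T : E} (f g : T ⟶ Mor), f ≫ tgt = g ≫ src → (T ⟶ Mor)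
  comp_natural : ∀ {S T : E} (s : S ⟶ T) (f g : T ⟶ Mor) (h : f ≫ tgt = g ≫ src),
    s ≫ comp f g h = comp (s ≫ f) (s ≫ g) (by simp [h])
  ident_src : ident ≫ src = 𝟙 Ob
  ident_tgt : ident ≫ tgt = 𝟙 Ob
  comp_src : ∀ {T : E} (f g : T ⟶ Mor) (h : f ≫ tgt = g ≫ src), comp f g h ≫ src = f ≫ src
  comp_tgt : ∀ {T : E} (f g : T ⟶ Mor) (h : f ≫ tgt = g ≫ src), comp f g h ≫ tgt = g ≫ tgt
  ident_comp : ∀ {T : E} (f : T ⟶ Mor), comp (f ≫ src ≫ ident) f (by simp [ident_tgt]) = f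
  comp_ident : ∀ {T : E} (f : T ⟶ Mor), comp f (f ≫ tgt ≫ ident) (by simp [ident_src]) = f
  assoc : ∀ {T : E} (f g k : T ⟶ Mor) (h : f ≫ tgt = g ≫ src) (h' : g ≫ tgt = k ≫ src),
    comp (comp f g h) k ((comp_tgt f g h).trans h') =
      comp f (comp g k h') (h.trans (comp_src g k h').symm)

variable {E : Type u} [Category.{v} E]

/-- `k` is the composite "first `f`, then `g`". -/
def InternalCategory.IsComp (C : InternalCategory E) {T : E} (f g k : T ⟶ C.Mor) : Prop :=
  ∃ h : f ≫ C.tgt = g ≫ C.src, C.comp f g h = k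

/-- An internal presheaf on `C`: the fibre of `proj` over `c` is the value at `c`, and
`act x f` is the restriction of `x` along `f`. -/
structure Presheaf (C : InternalCategory E) where
  obj : E
  proj : obj ⟶ C.Ob
  act : ∀ {T : E} (x : T ⟶ obj) (f : T ⟶ C.Mor), x ≫ proj = f ≫ C.tgt → (T ⟶ obj)
  act_natural : ∀ {S T : E} (s : S ⟶ T) (x : T ⟶ obj) (f : T ⟶ C.Mor)
    (h : x ≫ proj = f ≫ C.tgt), s ≫ act x f h = act (s ≫ x) (s ≫ f) (by simp [h])
  act_proj : ∀ {T : E} (x : T ⟶ obj) (f : T ⟶ C.Mor) (h : x ≫ proj = f ≫ C.tgt),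
    act x f h ≫ proj = f ≫ C.src
  act_ident : ∀ {T : E} (x : T ⟶ obj),
    act x (x ≫ proj ≫ C.ident) (by simp [C.ident_tgt]) = x
  act_comp : ∀ {T : E} (x : T ⟶ obj) (f g : T ⟶ C.Mor) (h : f ≫ C.tgt = g ≫ C.src)
    (hx : x ≫ proj = g ≫ C.tgt),
    act (act x g hx) f ((act_proj x g hx).trans h.symm) =
      act x (C.comp f g h) (hx.trans (C.comp_tgt f g h).symm)

namespace Presheaf

variable {C : InternalCategory E}

/-- A morphism of internal presheaves. -/
@[ext]
structure Hom (X Y : Presheaf C) where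
  hom : X.obj ⟶ Y.obj
  hom_proj : hom ≫ Y.proj = X.proj
  act_hom : ∀ {T : E} (x : T ⟶ X.obj) (f : T ⟶ C.Mor) (h : x ≫ X.proj = f ≫ C.tgt),
    X.act x f h ≫ hom = Y.act (x ≫ hom) f (by simp [hom_proj, h])

instance : Category (Presheaf C) where
  Hom := Hom
  id X := ⟨𝟙 _, by simp, by simp⟩
  comp u w := ⟨u.hom ≫ w.hom, by simp [u.hom_proj, w.hom_proj], fun x f h => by
    rw [← Category.assoc, u.act_hom, w.act_hom]
    simp only [Category.assoc]⟩
  id_comp _ := Hom.ext (Category.id_comp _)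
  comp_id _ := Hom.ext (Category.comp_id _)
  assoc _ _ _ := Hom.ext (Category.assoc _ _ _)

@[ext]
theorem hom_ext {X Y : Presheaf C} {u w : X ⟶ Y} (h : Hom.hom u = Hom.hom w) : u = w :=
  Hom.ext h

@[simp]
theorem id_hom (X : Presheaf C) : Hom.hom (𝟙 X) = 𝟙 X.obj := rfl

@[simp]
theorem comp_hom {X Y Z : Presheaf C} (u : X ⟶ Y) (w : Y ⟶ Z) :
    Hom.hom (u ≫ w) = Hom.hom u ≫ Hom.hom w := rfl

theorem act_congr (X : Presheaf C) {T : E} {x x' : T ⟶ X.obj} {f f' : T ⟶ C.Mor}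
    (hx : x = x') (hf : f = f') (h : x ≫ X.proj = f ≫ C.tgt) :
    X.act x f h = X.act x' f' (by rw [← hx, ← hf, h]) := by
  subst hx; subst hf; rfl

variable [HasFiniteLimits E]

/-- The binary product of presheaves: `(A × B)(c) = A(c) × B(c)`. -/
def prod (A B : Presheaf C) : Presheaf C where
  obj := pullback A.proj B.proj
  proj := pullback.fst A.proj B.proj ≫ A.proj
  act x f h := pullback.lift
    (A.act (x ≫ pullback.fst A.proj B.proj) f (by simpa using h))
    (B.act (x ≫ pullback.snd A.proj B.proj) f (by
      rw [Category.assoc, ← pullback.condition]; exact h))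
    (by rw [A.act_proj, B.act_proj])
  act_natural s x f h := by
    apply pullback.hom_ext
    · simp only [Category.assoc, pullback.lift_fst, A.act_natural]
    · simp only [Category.assoc, pullback.lift_snd, B.act_natural]
  act_proj x f h := by
    rw [← Category.assoc, pullback.lift_fst, A.act_proj]
  act_ident x := by
    apply pullback.hom_ext
    · rw [pullback.lift_fst]
      refine (A.act_congr rfl ?_ _).trans (A.act_ident _)
      simp only [Category.assoc]
    · rw [pullback.lift_snd]
      refine (B.act_congr rfl ?_ _).trans (B.act_ident _)
      simp only [Category.assoc, pullback.condition_assoc]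
  act_comp x f g h hx := by
    apply pullback.hom_ext
    · simp only [pullback.lift_fst]
      rw [← A.act_comp]
    · simp only [pullback.lift_snd]
      rw [← B.act_comp]

/-- The first projection of a binary product. -/
def fst (A B : Presheaf C) : prod A B ⟶ A where
  hom := pullback.fst A.proj B.proj
  hom_proj := rfl
  act_hom _ _ _ := pullback.lift_fst _ _ _

/-- The second projection of a binary product. -/
def snd (A B : Presheaf C) : prod A B ⟶ B where
  hom := pullback.snd A.proj B.proj
  hom_proj := pullback.condition.symm
  act_hom _ _ _ := pullback.lift_snd _ _ _

/-- The map into a binary product with given components. -/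
def lift {A B D : Presheaf C} (a : D ⟶ A) (b : D ⟶ B) : D ⟶ prod A B where
  hom := pullback.lift (Hom.hom a) (Hom.hom b) ((Hom.hom_proj a).trans (Hom.hom_proj b).symm)
  hom_proj := (pullback.lift_fst_assoc _ _ _ _).trans (Hom.hom_proj a)
  act_hom x f h := by
    apply pullback.hom_ext
    · refine (Category.assoc _ _ _).trans ?_
      rw [pullback.lift_fst, Hom.act_hom a]
      refine Eq.trans ?_ (pullback.lift_fst _ _ _).symm
      exact A.act_congr (((Category.assoc _ _ _).trans
        (congrArg (x ≫ ·) (pullback.lift_fst _ _ _))).symm) rfl _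
    · refine (Category.assoc _ _ _).trans ?_
      rw [pullback.lift_snd, Hom.act_hom b]
      refine Eq.trans ?_ (pullback.lift_snd _ _ _).symm
      exact B.act_congr (((Category.assoc _ _ _).trans
        (congrArg (x ≫ ·) (pullback.lift_snd _ _ _))).symm) rfl _

/-- The constant presheaf `Δ S`: its value at every object is `S`, and restriction acts trivially. -/
def constObj (C : InternalCategory E) (S : E) : Presheaf C where
  obj := S ⨯ C.Ob
  proj := Limits.prod.snd
  act x f _ := Limits.prod.lift (x ≫ Limits.prod.fst) (f ≫ C.src)
  act_natural s x f h := by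
    simp only [Limits.prod.comp_lift, Category.assoc]
  act_proj x f h := Limits.prod.lift_snd _ _
  act_ident x := by
    apply Limits.prod.hom_ext
    · rw [Limits.prod.lift_fst]
    · rw [Limits.prod.lift_snd, Category.assoc, Category.assoc, C.ident_src, Category.comp_id]
  act_comp x f g h hx := by
    apply Limits.prod.hom_ext
    · simp only [Limits.prod.lift_fst]
    · simp only [Limits.prod.lift_snd, C.comp_src]

/-- The constant presheaf functor `Δ`. -/
def const (C : InternalCategory E) : E ⥤ Presheaf C where
  obj S := constObj C S
  map u :=
    { hom := Limits.prod.map u (𝟙 _)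
      hom_proj := (Limits.prod.map_snd _ _).trans (Category.comp_id _)
      act_hom := fun {T} x f _ => by
        have key : ∀ (x : T ⟶ _ ⨯ C.Ob) (g : T ⟶ C.Ob),
            Limits.prod.lift (x ≫ Limits.prod.fst) g ≫ Limits.prod.map u (𝟙 C.Ob) =
              Limits.prod.lift ((x ≫ Limits.prod.map u (𝟙 C.Ob)) ≫ Limits.prod.fst) g :=
          fun x g => by simp
        exact key x (f ≫ C.src) }
  map_id S := hom_ext Limits.prod.map_id_id
  map_comp u w := hom_ext ((congrArg (Limits.prod.map (u ≫ w))
    (Category.comp_id (𝟙 C.Ob)).symm).trans (Limits.prod.map_map _ _ _ _).symm)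

/-- The map from a presheaf to the terminal presheaf `Δ 1`. -/
def toPoint (A : Presheaf C) : A ⟶ (const C).obj (⊤_ E) where
  hom := Limits.prod.lift (terminal.from _) A.proj
  hom_proj := Limits.prod.lift_snd _ _
  act_hom x f h := by
    refine Limits.prod.hom_ext (Subsingleton.elim _ _) ?_
    refine (Category.assoc _ _ _).trans ?_
    rw [Limits.prod.lift_snd, A.act_proj]
    exact (Limits.prod.lift_snd _ _).symm

/-- The representable presheaf `y c` of an object `c` of `C`: its value at `d` is the object of
morphisms `d ⟶ c`, and restriction is precomposition. -/
def yoneda (C : InternalCategory E) (c : ⊤_ E ⟶ C.Ob) : Presheaf C where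
  obj := pullback C.tgt c
  proj := pullback.fst C.tgt c ≫ C.src
  act x f h := pullback.lift
    (C.comp f (x ≫ pullback.fst C.tgt c) (by simpa using h.symm))
    (x ≫ pullback.snd C.tgt c)
    (by rw [C.comp_tgt, Category.assoc, Category.assoc, pullback.condition])
  act_natural s x f h := by
    apply pullback.hom_ext
    · simp only [Category.assoc, pullback.lift_fst, C.comp_natural]
    · simp only [Category.assoc, pullback.lift_snd]
  act_proj x f h := by
    rw [← Category.assoc, pullback.lift_fst, C.comp_src]
  act_ident x := by
    apply pullback.hom_ext
    · rw [pullback.lift_fst]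
      have := C.ident_comp (x ≫ pullback.fst C.tgt c)
      simpa only [Category.assoc] using this
    · rw [pullback.lift_snd]
  act_comp x f g h hx := by
    apply pullback.hom_ext
    · simp only [pullback.lift_fst]
      rw [C.assoc]
    · simp only [pullback.lift_snd]

end Presheaf

/-! ## Cube categories and cubical sets -/

variable [HasFiniteLimits E]

/-- A category of cubes in `E`: an internal category with finite products and an object `I`
(`interval`) such that each object is isomorphic to a power of `I`, together with two endpoints of
`I`. The endpoints, which are global sections of `I`, are given as maps `1 ⟶ y I` of presheaves. -/
structure CubeCategory (ℕE : NaturalNumbersObject E) extends InternalCategory E where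
  /-- the terminal object -/
  pt : ⊤_ E ⟶ Ob
  existsUnique_to_pt : ∀ {T : E} (c : T ⟶ Ob),
    ∃! f : T ⟶ Mor, f ≫ src = c ∧ f ≫ tgt = terminal.from T ≫ pt
  /-- binary products and their projections -/
  prodOb : Ob ⨯ Ob ⟶ Ob
  prodFst : Ob ⨯ Ob ⟶ Mor
  prodSnd : Ob ⨯ Ob ⟶ Mor
  prodFst_src : prodFst ≫ src = prodOb
  prodFst_tgt : prodFst ≫ tgt = Limits.prod.fst
  prodSnd_src : prodSnd ≫ src = prodOb
  prodSnd_tgt : prodSnd ≫ tgt = Limits.prod.snd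
  existsUnique_lift : ∀ {T : E} (f g : T ⟶ Mor), f ≫ src = g ≫ src →
    ∃! h : T ⟶ Mor,
      toInternalCategory.IsComp h (Limits.prod.lift (f ≫ tgt) (g ≫ tgt) ≫ prodFst) f ∧
      toInternalCategory.IsComp h (Limits.prod.lift (f ≫ tgt) (g ≫ tgt) ≫ prodSnd) g
  /-- the object `I` -/
  interval : ⊤_ E ⟶ Ob
  /-- the powers of `I`, as a map from the natural number object -/
  pow : ℕE.N ⟶ Ob
  pow_zero : ℕE.zero ≫ pow = pt
  pow_succ : ℕE.succ ≫ pow = Limits.prod.lift pow (terminal.from _ ≫ interval) ≫ prodOb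
  /-- "for each object `c` there is `n` with `c` isomorphic to the `n`-th power of `I`", where the
  existential quantifier of regular logic is witnessed on a cover `e` of the object of objects -/
  exists_pow : ∃ (T : E) (e : T ⟶ Ob) (n : T ⟶ ℕE.N) (i j : T ⟶ Mor),
    IsRegularEpi e ∧ i ≫ src = e ∧ i ≫ tgt = n ≫ pow ∧
    toInternalCategory.IsComp i j (e ≫ ident) ∧
    toInternalCategory.IsComp j i (n ≫ pow ≫ ident)
  zero : (Presheaf.const toInternalCategory).obj (⊤_ E) ⟶
    Presheaf.yoneda toInternalCategory interval
  one : (Presheaf.const toInternalCategory).obj (⊤_ E) ⟶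
    Presheaf.yoneda toInternalCategory interval

namespace CubeCategory

variable {ℕE : NaturalNumbersObject E} (B : CubeCategory ℕE)

/-- Cubical sets: the internal presheaves on the category of cubes. -/
abbrev CSet := Presheaf B.toInternalCategory

/-- The constant presheaf functor. -/
abbrev Δ : E ⥤ B.CSet := Presheaf.const B.toInternalCategory

/-- The representable `y I`. -/
abbrev yI : B.CSet := Presheaf.yoneda B.toInternalCategory B.interval

variable {B}

/-- `H` is a homotopy from `a` to `b`. -/
def IsHomotopy {A X : B.CSet} (a b : A ⟶ X) (H : Presheaf.prod B.yI A ⟶ X) : Prop :=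
  Presheaf.lift (A.toPoint ≫ B.zero) (𝟙 A) ≫ H = a ∧
    Presheaf.lift (A.toPoint ≫ B.one) (𝟙 A) ≫ H = b

/-- Homotopy of maps. -/
def Homotopic {A X : B.CSet} (a b : A ⟶ X) : Prop :=
  ∃ H : Presheaf.prod B.yI A ⟶ X, IsHomotopy a b H

/-- Homotopy over `Y` of two maps into `f : X ⟶ Y`: a homotopy that is constant after composing with
`f`. Such homotopies are the maps from `A` to the path object `Path_Y(X)`, the pullback of
`X ^ I ⟶ Y ^ I` along the diagonal `Y ⟶ Y ^ I`. -/
def FibrewiseHomotopic {A X Y : B.CSet} (f : X ⟶ Y) (a b : A ⟶ X) : Prop :=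
  ∃ H : Presheaf.prod B.yI A ⟶ X, IsHomotopy a b H ∧ H ≫ f = Presheaf.snd B.yI A ≫ a ≫ f

/-- The map `Path_Y(X) ⟶ X ×_Y X` has a section; equivalently, each generalized element
`(a, b) : A ⟶ X ×_Y X` lifts to `Path_Y(X)`. -/
def PathSection {X Y : B.CSet} (f : X ⟶ Y) : Prop :=
  ∀ {A : B.CSet} (a b : A ⟶ X), a ≫ f = b ≫ f → FibrewiseHomotopic f a b

/-- `f` and `g` are equivalent over `Y`. -/
def FibrewiseEquivalent {X X' Y : B.CSet} (f : X ⟶ Y) (g : X' ⟶ Y) : Prop :=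
  ∃ (u : X ⟶ X') (w : X' ⟶ X), u ≫ g = f ∧ w ≫ f = g ∧
    FibrewiseHomotopic f (u ≫ w) (𝟙 X) ∧ FibrewiseHomotopic g (w ≫ u) (𝟙 X')

/-- `f : X ⟶ Y` is a homotopy pullback along `χ` of the fibration `m`: it is equivalent over `Y` to a
(strict) pullback of `m` along `χ`. -/
def IsHomotopyPullback {X Y Q P : B.CSet} (f : X ⟶ Y) (m : Q ⟶ P) (χ : Y ⟶ P) : Prop :=
  ∃ (X' : B.CSet) (f' : X' ⟶ Y) (t : X' ⟶ Q), IsPullback t f' m χ ∧ FibrewiseEquivalent f f'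

/-- `m` is a homotopy classifier of the class `W`: it belongs to `W`, and each member of `W` is a
homotopy pullback of `m` along a map that is unique up to homotopy. -/
def IsHomotopyClassifier (W : MorphismProperty B.CSet) {Q P : B.CSet} (m : Q ⟶ P) : Prop :=
  W m ∧ ∀ {X Y : B.CSet} (f : X ⟶ Y), W f →
    (∃ χ : Y ⟶ P, IsHomotopyPullback f m χ) ∧
    ∀ χ χ' : Y ⟶ P, IsHomotopyPullback f m χ → IsHomotopyPullback f m χ' → Homotopic χ χ'

end CubeCategory

/-- A notion of Kan fibration on the cubical sets over `B`; `fib f` says that `f` has a Kan fibration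
structure. In `hurewicz`, the point `d` of `y I` may depend on a parameter from an object `T` of the
ambient category over which `A` lives: this is the internal reading of "for each cubical set `A` and
each point `d : 1 ⟶ y I`, the map `d × A` is a trivial cofibration". -/
structure KanFibrations {ℕE : NaturalNumbersObject E} (B : CubeCategory ℕE) where
  fib : MorphismProperty B.CSet
  baseChange : fib.IsStableUnderBaseChange
  composition : fib.IsStableUnderComposition
  dependentProduct : ∀ {X Y Z P : B.CSet} (f : X ⟶ Y) (g : Y ⟶ Z) (π : P ⟶ Z),
    fib f → fib g → IsDependentProduct f g π → fib π
  const : ∀ {S T : E} (u : S ⟶ T), fib (B.Δ.map u)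
  hurewicz : ∀ {A : B.CSet} {T : E} (q : A ⟶ B.Δ.obj T) (d : B.Δ.obj T ⟶ B.yI)
    {X Y : B.CSet} (f : X ⟶ Y), fib f → HasLiftingProperty (Presheaf.lift (q ≫ d) (𝟙 A)) f

namespace KanFibrations

variable {ℕE : NaturalNumbersObject E} {B : CubeCategory ℕE} (K : KanFibrations B)

/-- A homotopy proposition (in context `Y`). -/
def HProp : MorphismProperty B.CSet :=
  fun _ _ f => K.fib f ∧ CubeCategory.PathSection f

/-- A `¬¬`-stable homotopy proposition. -/
def NegNegStableHProp : MorphismProperty B.CSet :=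
  fun _ _ f => K.HProp f ∧ NegNegStable f

end KanFibrations

end CubicalModel

end

/-! A map `Y ⟶ Δ Ω` is a map `Y.obj ⟶ Ω` that is invariant under restriction along cube maps. A
subpresheaf of `Y` is therefore a pullback of `Δ m` as soon as its underlying monomorphism is
`¬¬`-stable and membership of `y` is equivalent to membership of every restriction `y · g`.

Let `f : X ⟶ Y` be a `¬¬`-stable h-proposition. The double negation `¬¬f` is a monomorphism, hence
satisfies the path condition. There are maps over `Y` both ways between `f` and `¬¬f`, so the two
are homotopy equivalent, and it is enough to classify `¬¬f` strictly. The invariance of `¬¬f`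
reduces to this: the fibre of `f` over `y` is empty if and only if the fibre over `y · g` is. One
direction is restriction of elements. The other, `restrictsEmptiness_of_fib`, is where fibrancy
enters. An element over `y · g` restricts along a point of the source of `g` to an element over a
vertex of `y`. Cubes are locally powers `I^n`, and lifting against `d × A` moves an element from a
face of a cube to the whole cube, so by induction on `n` the fibre over `y` cannot be empty. The
induction is internal and concerns a negative statement, which defines a subobject of the natural
numbers by means of a pseudocomplement.

Negation of presheaves ordinarily quantifies over all restrictions. Once emptiness is invariant,
`¬f` and `¬¬f` are computed on underlying objects (`RestrictsEmptiness.isPseudocomplement_hom`), so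
the classifier in `E` applies to the underlying map of `¬¬f` (`exists_classifyingMap`).

Uniqueness is even strict. Two strict pullbacks of `Δ m` that are both equivalent to `f` over `Y`
are the same subobject of `Y`, so extensionality of `m` makes the classifying maps equal
(`eq_of_isHomotopyPullback`). -/

noncomputable section

namespace CubicalModel

/-! ## Negation in a category with strict initial objects -/

section Negation

variable {C : Type u} [Category.{v} C]

/-- `T` is an initial object. -/
def Vacuous (T : C) : Prop := Nonempty (IsInitial T)

/-- The fibre product of `f` and `a` is empty: "`¬ X_a`". -/
def DisjointOver {X Y A : C} (f : X ⟶ Y) (a : A ⟶ Y) : Prop :=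
  ∀ ⦃S : C⦄ (x : S ⟶ X) (s : S ⟶ A), x ≫ f = s ≫ a → Vacuous S

theorem DisjointOver.precomp {X Y A A' : C} {f : X ⟶ Y} {a : A ⟶ Y} (h : DisjointOver f a)
    (r : A' ⟶ A) : DisjointOver f (r ≫ a) :=
  fun _ x s hs => h x (s ≫ r) (by rw [hs, Category.assoc])

/-- `n` is the largest subobject of `Y` that is disjoint from `f`. -/
structure IsPseudocomplement {X Y N : C} (f : X ⟶ Y) (n : N ⟶ Y) : Prop where
  mono : Mono n
  factors_iff : ∀ {A : C} (a : A ⟶ Y), (∃ t : A ⟶ N, t ≫ n = a) ↔ DisjointOver f a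

theorem IsPseudocomplement.disjoint {X Y N : C} {f : X ⟶ Y} {n : N ⟶ Y}
    (h : IsPseudocomplement f n) : DisjointOver f n :=
  (h.factors_iff n).1 ⟨𝟙 N, Category.id_comp n⟩

theorem IsPseudocomplement.disjoint_symm {X Y N : C} {f : X ⟶ Y} {n : N ⟶ Y}
    (h : IsPseudocomplement f n) : DisjointOver n f :=
  fun _ x s hs => h.disjoint s x hs.symm

/-- The inclusion of a proposition into its double negation. -/
theorem IsPseudocomplement.exists_unit {X Y N M : C} {f : X ⟶ Y} {n : N ⟶ Y} {k : M ⟶ Y}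
    (hn : IsPseudocomplement f n) (hk : IsPseudocomplement n k) : ∃ t : X ⟶ M, t ≫ k = f :=
  (hk.factors_iff f).2 hn.disjoint_symm

theorem IsPseudocomplement.exists_iso {X Y N M : C} {f : X ⟶ Y} {n : N ⟶ Y} {k : M ⟶ Y}
    (hn : IsPseudocomplement f n) (hk : IsPseudocomplement f k) :
    ∃ e : N ≅ M, e.hom ≫ k = n := by
  obtain ⟨s, hs⟩ := (hk.factors_iff n).2 hn.disjoint
  obtain ⟨t, ht⟩ := (hn.factors_iff k).2 hk.disjoint
  have := hn.mono
  have := hk.mono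
  exact ⟨⟨s, t, by rw [← cancel_mono n]; simp [ht, hs], by rw [← cancel_mono k]; simp [ht, hs]⟩, hs⟩

theorem IsPseudocomplement.of_iso {X Y N M : C} {f : X ⟶ Y} {n : N ⟶ Y} {k : M ⟶ Y}
    (hn : IsPseudocomplement f n) (e : M ≅ N) (he : e.hom ≫ n = k) : IsPseudocomplement f k where
  mono := by
    have := hn.mono
    rw [← he]
    infer_instance
  factors_iff a := by
    rw [← hn.factors_iff]
    constructor
    · rintro ⟨t, ht⟩
      exact ⟨t ≫ e.hom, by rw [Category.assoc, he, ht]⟩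
    · rintro ⟨t, ht⟩
      exact ⟨t ≫ e.inv, by rw [Category.assoc, ← he, e.inv_hom_id_assoc, ht]⟩

theorem Vacuous.hom_ext {T X : C} (h : Vacuous T) (s t : T ⟶ X) : s = t :=
  h.some.hom_ext s t

variable [HasStrictInitialObjects C]

theorem Vacuous.of_hom {S T : C} (h : Vacuous T) (s : S ⟶ T) : Vacuous S := by
  obtain ⟨hT⟩ := h
  have := hT.isIso_to s
  exact ⟨hT.ofIso (asIso s).symm⟩

theorem disjointOver_iff_of_isPullback {X Y A P : C} {f : X ⟶ Y} {a : A ⟶ Y} {p : P ⟶ X}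
    {q : P ⟶ A} (h : IsPullback p q f a) : DisjointOver f a ↔ Vacuous P :=
  ⟨fun hf => hf p q h.w, fun hP _ x s hs => hP.of_hom (h.lift x s hs)⟩

/-- Emptiness is local: a map out of a strict initial object is a monomorphism, and a regular
epimorphism that is monic is invertible. This allows arguments about cubes to be made on a cover,
where witnesses of existential statements can be chosen. -/
theorem Vacuous.of_isRegularEpi {S T : C} (h : Vacuous S) (s : S ⟶ T) [IsRegularEpi s] :
    Vacuous T := by
  have hS := h
  obtain ⟨hI⟩ := h
  have : Mono s := ⟨fun g k _ => hI.strict_hom_ext g k⟩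
  have := isIso_of_regularEpi_of_mono s (IsRegularEpi.getStruct s)
  exact hS.of_hom (inv s)

variable [HasPullbacks C]

/-- By strictness, a map from `f^* A` to the empty family over `X` exists only if `f^* A` is itself
empty, and is then unique. The exponential `⊥ ^ f` therefore carries no data beyond a subobject. -/
theorem IsNegation.isPseudocomplement {X Y N : C} {f : X ⟶ Y} {n : N ⟶ Y}
    (h : IsNegation f n) : IsPseudocomplement f n := by
  obtain ⟨Z, hZ, Q, q₁, q₂, ev, hQ, -, hu⟩ := h
  have hn : DisjointOver f n := (disjointOver_iff_of_isPullback hQ.flip).2 (.of_hom ⟨hZ⟩ ev)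
  have key : ∀ {A : C} (a : A ⟶ Y), DisjointOver f a → ∃! t : A ⟶ N, t ≫ n = a := by
    intro A a ha
    have hB := IsPullback.of_hasPullback a f
    have hBv := (disjointOver_iff_of_isPullback hB.flip).1 ha
    obtain ⟨t, ⟨ht, -⟩, h⟩ := hu a _ _ hB (hBv.some.to Z) (hBv.hom_ext _ _)
    exact ⟨t, ht, fun t' ht' => h t' ⟨ht', fun _ _ _ => hBv.hom_ext _ _⟩⟩
  refine ⟨⟨fun {A} t t' h => (key _ (hn.precomp t')).unique h rfl⟩, fun {A} a => ⟨?_, fun ha => ?_⟩⟩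
  · rintro ⟨t, rfl⟩
    exact hn.precomp t
  · exact (key a ha).exists

theorem IsPseudocomplement.isNegation [HasInitial C] {X Y N : C} {f : X ⟶ Y} {n : N ⟶ Y}
    (h : IsPseudocomplement f n) : IsNegation f n := by
  have hQ := IsPullback.of_hasPullback n f
  have hQv := (disjointOver_iff_of_isPullback hQ.flip).1 h.disjoint
  refine ⟨⊥_ C, initialIsInitial, _, _, _, hQv.some.to _, hQ, hQv.hom_ext _ _, ?_⟩
  intro A B a k b hB e _
  have hBv : Vacuous B := .of_hom ⟨initialIsInitial⟩ e
  obtain ⟨t, ht⟩ := (h.factors_iff a).2 ((disjointOver_iff_of_isPullback hB.flip).2 hBv)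
  have := h.mono
  exact ⟨t, ⟨ht, fun _ _ _ => hBv.hom_ext _ _⟩,
    fun t' ht' => by rw [← cancel_mono n, ht, ht'.1]⟩

/-- A negation is `¬¬`-stable: `¬¬¬ X` implies `¬ X`. -/
theorem IsPseudocomplement.negNegStable [HasInitial C] {X Y N N₂ N₃ : C} {f : X ⟶ Y} {n : N ⟶ Y}
    {n₂ : N₂ ⟶ Y} {n₃ : N₃ ⟶ Y} (h : IsPseudocomplement f n) (h₂ : IsPseudocomplement n n₂)
    (h₃ : IsPseudocomplement n₂ n₃) : NegNegStable n := by
  refine ⟨N₂, N₃, n₂, n₃, h₂.isNegation, h₃.isNegation, (h.factors_iff n₃).2 fun _ x s hs => ?_⟩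
  obtain ⟨t, ht⟩ := h.exists_unit h₂
  exact h₃.disjoint (x ≫ t) s (by rw [Category.assoc, ht, hs])

end Negation

/-! ## Locally cartesian closed categories -/

section LocallyCartesianClosed

variable {C : Type u} [Category.{v} C] [HasFiniteLimits C]

/-- Induction over the natural number object for subobjects. -/
theorem NaturalNumbersObject.exists_section (ℕE : NaturalNumbersObject C) {M : C} (i : M ⟶ ℕE.N)
    (z : ⊤_ C ⟶ M) (hz : z ≫ i = ℕE.zero) (s : M ⟶ M) (hs : s ≫ i = i ≫ ℕE.succ) :
    ∃ r : ℕE.N ⟶ M, r ≫ i = 𝟙 _ := by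
  obtain ⟨r, ⟨h₀, h₁⟩, -⟩ := ℕE.existsUnique_rec z s
  refine ⟨r, (ℕE.existsUnique_rec ℕE.zero ℕE.succ).unique ⟨?_, ?_⟩ ⟨?_, ?_⟩⟩
  · rw [reassoc_of% h₀, hz]
  · rw [reassoc_of% h₁, hs, Category.assoc]
  · rw [Category.comp_id]
  · rw [Category.comp_id, Category.id_comp]

variable [LocallyCartesianClosed C]

/-- Pullback along `a : A ⟶ Z` is a left adjoint, so it sends the initial object `𝟙 Z` of the slice
over `Z` to an initial object of the slice over `A`, and this is isomorphic to `𝟙 A`. Maps `A ⟶ B`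
are maps over `A` from `𝟙 A` to `B ⨯ A`, so there is exactly one. -/
theorem vacuous_of_hom_of_isInitial {Z A : C} (hZ : IsInitial Z) (a : A ⟶ Z) : Vacuous A := by
  have := LocallyCartesianClosed.isLeftAdjoint a
  have h₁ : IsInitial (Over.mk (𝟙 Z)) :=
    IsInitial.ofUniqueHom (fun U => Over.homMk (hZ.to _) (hZ.hom_ext _ _))
      fun U m => by ext; exact hZ.hom_ext _ _
  have h₂ := IsInitial.isInitialObj (Over.pullback a) _ h₁
  have hiso : IsIso (pullback.snd (𝟙 Z) a) := inferInstance
  have key : ∀ (B : C), Nonempty (Unique (A ⟶ B)) := by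
    intro B
    let U : Over A := Over.mk (Limits.prod.snd : B ⨯ A ⟶ A)
    refine ⟨⟨⟨inv (pullback.snd (𝟙 Z) a) ≫ (h₂.to U).left ≫ Limits.prod.fst⟩, fun g => ?_⟩⟩
    have hg : (Over.homMk (pullback.snd (𝟙 Z) a ≫ Limits.prod.lift g (𝟙 A))
        ((Category.assoc _ _ _).trans ((congrArg _ (Limits.prod.lift_snd _ _)).trans
          (Category.comp_id _))) :
        (Over.pullback a).obj (Over.mk (𝟙 Z)) ⟶ U) = h₂.to U := h₂.hom_ext _ _
    refine (IsIso.eq_inv_comp _).2 ?_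
    rw [← hg]
    exact ((Category.assoc _ _ _).trans (congrArg _ (Limits.prod.lift_fst _ _))).symm
  exact ⟨IsInitial.ofUnique A (h := fun B => (key B).some)⟩

instance : HasStrictInitialObjects C where
  out {I A} f hI := by
    obtain ⟨hA⟩ := vacuous_of_hom_of_isInitial hI f
    exact ⟨hI.to A, hA.hom_ext _ _, hI.hom_ext _ _⟩

/-- The right adjoint of pullback along `f` is applied to the empty family over `X`. By adjunction,
maps into the result correspond to maps into an initial object, which are unique and force their
domain to be empty. -/
theorem exists_isPseudocomplement [HasInitial C] {X Y : C} (f : X ⟶ Y) :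
    ∃ (N : C) (n : N ⟶ Y), IsPseudocomplement f n := by
  have := LocallyCartesianClosed.isLeftAdjoint f
  let adj := Adjunction.ofIsLeftAdjoint (Over.pullback f)
  let Z : Over X := Over.mk (initial.to X)
  let R := (Over.pullback f).rightAdjoint.obj Z
  have key : ∀ {A : C} (a : A ⟶ Y) , Nonempty (Over.mk a ⟶ R) ↔ DisjointOver f a := by
    intro A a
    rw [disjointOver_iff_of_isPullback (IsPullback.of_hasPullback a f).flip,
      (adj.homEquiv (Over.mk a) Z).symm.nonempty_congr]
    constructor
    · rintro ⟨t⟩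
      exact vacuous_of_hom_of_isInitial initialIsInitial t.left
    · exact fun h => ⟨Over.homMk (h.some.to _) (h.hom_ext _ _)⟩
  refine ⟨R.left, R.hom, ⟨fun {A} s t h => ?_⟩, fun {A} a => ?_⟩
  · let s' : Over.mk (s ≫ R.hom) ⟶ R := Over.homMk s
    let t' : Over.mk (s ≫ R.hom) ⟶ R := Over.homMk t h.symm
    suffices s' = t' from congrArg CommaMorphism.left this
    apply (adj.homEquiv (Over.mk (s ≫ R.hom)) Z).symm.injective
    ext
    exact initialIsInitial.strict_hom_ext _ _
  · rw [← key]
    exact ⟨fun ⟨t, ht⟩ => ⟨Over.homMk t ht⟩, fun ⟨t⟩ => ⟨t.left, Over.w t⟩⟩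

/-- Induction for statements `∀ w : W n, ⊥` about a natural number `n`. -/
theorem NaturalNumbersObject.disjointOver_of_induction [HasInitial C] (ℕE : NaturalNumbersObject C)
    {W : C} (w : W ⟶ ℕE.N) (h₀ : DisjointOver w ℕE.zero)
    (h₁ : ∀ {T : C} (n : T ⟶ ℕE.N), DisjointOver w n → DisjointOver w (n ≫ ℕE.succ)) :
    Vacuous W := by
  -- `M` is the subobject of those `n` for which the fibre `W n` is empty. The two hypotheses say
  -- that it contains zero and is closed under successor.
  obtain ⟨M, i, hi⟩ := exists_isPseudocomplement w
  obtain ⟨z, hz⟩ := (hi.factors_iff _).2 h₀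
  obtain ⟨s, hs⟩ := (hi.factors_iff _).2 (h₁ i hi.disjoint)
  obtain ⟨r, hr⟩ := ℕE.exists_section i z hz s hs
  exact (hi.factors_iff (𝟙 _)).1 ⟨r, hr⟩ (𝟙 W) w (by simp)

end LocallyCartesianClosed

/-! ### Subpresheaves and objectwise pullbacks -/

namespace Presheaf

variable {E : Type u} [Category.{v} E] {C : InternalCategory E}

theorem act_hom {X Y : Presheaf C} (u : X ⟶ Y) {T : E} (x : T ⟶ X.obj) (f : T ⟶ C.Mor)
    (h : x ≫ X.proj = f ≫ C.tgt) :
    X.act x f h ≫ Hom.hom u = Y.act (x ≫ Hom.hom u) f (by rw [Category.assoc, Hom.hom_proj u, h]) :=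
  Hom.act_hom u x f h

theorem hom_proj {X Y : Presheaf C} (u : X ⟶ Y) : Hom.hom u ≫ Y.proj = X.proj :=
  Hom.hom_proj u

/-- A factorization of a morphism of presheaves through a monomorphism of underlying objects is a
morphism of presheaves. -/
def factor {A N Y : Presheaf C} (a : A ⟶ Y) (n : N ⟶ Y) [Mono (Hom.hom n)] (t : A.obj ⟶ N.obj)
    (ht : t ≫ Hom.hom n = Hom.hom a) : A ⟶ N where
  hom := t
  hom_proj := by rw [← hom_proj n, reassoc_of% ht, hom_proj]
  act_hom x f h := by
    rw [← cancel_mono (Hom.hom n), act_hom]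
    refine (Category.assoc _ _ _).trans ((congrArg _ ht).trans ((act_hom _ _ _ _).trans ?_))
    exact act_congr _ (by rw [Category.assoc, ht]) rfl _

theorem factor_comp {A N Y : Presheaf C} (a : A ⟶ Y) (n : N ⟶ Y) [Mono (Hom.hom n)]
    (t : A.obj ⟶ N.obj) (ht : t ≫ Hom.hom n = Hom.hom a) : factor a n t ht ≫ n = a :=
  hom_ext ht

/-- The subpresheaf of `Y` on a subobject of `Y.obj` that is closed under restriction. -/
def sub (Y : Presheaf C) {M : E} (i : M ⟶ Y.obj) [Mono i]
    (hi : ∀ {T : E} (t : T ⟶ M) (f : T ⟶ C.Mor) (h : (t ≫ i) ≫ Y.proj = f ≫ C.tgt),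
      ∃ r : T ⟶ M, r ≫ i = Y.act (t ≫ i) f h) : Presheaf C where
  obj := M
  proj := i ≫ Y.proj
  act x f h := Exists.choose (hi x f (by rw [Category.assoc, h]))
  act_natural s x f h := by
    rw [← cancel_mono i, Category.assoc, Exists.choose_spec (hi x f _), Y.act_natural,
      Exists.choose_spec (hi (s ≫ x) (s ≫ f) _)]
    exact act_congr _ (Category.assoc _ _ _).symm rfl _
  act_proj x f h := by
    rw [← Category.assoc, Exists.choose_spec (hi x f _), Y.act_proj]
  act_ident x := by
    rw [← cancel_mono i, Exists.choose_spec (hi x _ _)]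
    exact (act_congr _ rfl (by simp only [Category.assoc]) _).trans (Y.act_ident (x ≫ i))
  act_comp x f g h hx := by
    refine (cancel_mono i).1 ((Exists.choose_spec (hi _ f _)).trans
      ((act_congr _ (Exists.choose_spec (hi x g _)) rfl _).trans
        ((Y.act_comp (x ≫ i) f g h (by rw [Category.assoc, hx])).trans
          (Exists.choose_spec (hi x _ _)).symm)))

/-- The inclusion of a subpresheaf. -/
def subι (Y : Presheaf C) {M : E} (i : M ⟶ Y.obj) [Mono i]
    (hi : ∀ {T : E} (t : T ⟶ M) (f : T ⟶ C.Mor) (h : (t ≫ i) ≫ Y.proj = f ≫ C.tgt),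
      ∃ r : T ⟶ M, r ≫ i = Y.act (t ≫ i) f h) : Y.sub i hi ⟶ Y where
  hom := i
  hom_proj := rfl
  act_hom x f _ := Exists.choose_spec (hi x f _)

theorem mono_of_mono_hom {X Y : Presheaf C} (u : X ⟶ Y) [Mono (Hom.hom u)] : Mono u :=
  ⟨fun _ _ e => hom_ext ((cancel_mono (Hom.hom u)).1 (congrArg Hom.hom e))⟩

theorem isPullback_of_hom {P X Y Z : Presheaf C} {p : P ⟶ X} {q : P ⟶ Y} {f : X ⟶ Z}
    {g : Y ⟶ Z} (h : IsPullback (Hom.hom p) (Hom.hom q) (Hom.hom f) (Hom.hom g)) :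
    IsPullback p q f g := by
  refine ⟨⟨hom_ext h.w⟩, ⟨PullbackCone.IsLimit.mk _
    (fun s => ⟨h.lift (Hom.hom s.fst) (Hom.hom s.snd) (congrArg Hom.hom s.condition), ?_, ?_⟩)
    (fun s => hom_ext (h.lift_fst _ _ _)) (fun s => hom_ext (h.lift_snd _ _ _))
    (fun s m hm₁ hm₂ => hom_ext (h.hom_ext ?_ ?_))⟩⟩
  · rw [← hom_proj p, h.lift_fst_assoc, hom_proj]
  · intro T x k hk
    apply h.hom_ext
    · rw [Category.assoc, h.lift_fst, act_hom, act_hom]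
      exact act_congr _ (by rw [Category.assoc, h.lift_fst]) rfl _
    · rw [Category.assoc, h.lift_snd, act_hom, act_hom]
      exact act_congr _ (by rw [Category.assoc, h.lift_snd]) rfl _
  · exact (congrArg Hom.hom hm₁).trans (h.lift_fst _ _ _).symm
  · exact (congrArg Hom.hom hm₂).trans (h.lift_snd _ _ _).symm

/-! ## Negation of presheaves -/

/-- An element of the fibre over `y` restricts along `g` to one over `y · g`. -/
theorem disjointOver_of_act {X Y : Presheaf C} (f : X ⟶ Y) {T : E} {y : T ⟶ Y.obj}
    {g : T ⟶ C.Mor} {h : y ≫ Y.proj = g ≫ C.tgt} (hd : DisjointOver (Hom.hom f) (Y.act y g h)) :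
    DisjointOver (Hom.hom f) y := by
  intro S x s hs
  have hx : x ≫ X.proj = (s ≫ g) ≫ C.tgt := by
    rw [← hom_proj f, reassoc_of% hs, h, Category.assoc]
  refine hd (X.act x (s ≫ g) hx) s ?_
  rw [act_hom, act_natural]
  exact act_congr _ hs rfl _

/-- `¬ X_y` implies `¬ X_{y · g}`. -/
def RestrictsEmptiness {X Y : Presheaf C} (f : X ⟶ Y) : Prop :=
  ∀ ⦃T : E⦄ (y : T ⟶ Y.obj) (g : T ⟶ C.Mor) (h : y ≫ Y.proj = g ≫ C.tgt),
    DisjointOver (Hom.hom f) y → DisjointOver (Hom.hom f) (Y.act y g h)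

/-- If the fibre of `n` over `y · g` is inhabited, that of `f` over `y · g` is empty, hence that of
`f` over `y` is empty too, which inhabits the fibre of `n` over `y`. This needs no fibrancy of `n`,
so negation can be iterated objectwise. -/
theorem restrictsEmptiness_of_isPseudocomplement_hom {X Y N : Presheaf C} {f : X ⟶ Y}
    {n : N ⟶ Y} (hn : IsPseudocomplement (Hom.hom f) (Hom.hom n)) :
    RestrictsEmptiness n := by
  intro T y g h hd S x s hs
  have h₁ := hn.disjoint.precomp x
  rw [hs, act_natural] at h₁
  obtain ⟨t, ht⟩ := (hn.factors_iff _).2 (disjointOver_of_act f h₁)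
  exact hd t s ht

section Empty

variable [HasStrictInitialObjects E]

theorem vacuous_of_vacuous_obj {X : Presheaf C} (h : Vacuous X.obj) : Vacuous X :=
  ⟨IsInitial.ofUniqueHom
    (fun _ => ⟨h.some.to _, h.hom_ext _ _, fun x _ _ => (h.of_hom x).hom_ext _ _⟩)
    fun _ _ => hom_ext (h.hom_ext _ _)⟩

variable [HasInitial E]

variable (C) in
/-- The empty presheaf. -/
def empty : Presheaf C where
  obj := ⊥_ E
  proj := initial.to _
  act x _ _ := x
  act_natural _ _ _ _ := rfl
  act_proj x _ _ := (Vacuous.of_hom ⟨initialIsInitial⟩ x).hom_ext _ _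
  act_ident _ := rfl
  act_comp _ _ _ _ _ := rfl

theorem vacuous_obj {X : Presheaf C} (h : Vacuous X) : Vacuous X.obj :=
  .of_hom ⟨initialIsInitial⟩ (Hom.hom (h.some.to (empty C)))

instance : HasStrictInitialObjects (Presheaf C) where
  out f hI := by
    have hI' : Vacuous _ := ⟨hI⟩
    obtain ⟨hA⟩ := vacuous_of_vacuous_obj ((vacuous_obj hI').of_hom (Hom.hom f))
    exact ⟨hI.to _, hA.hom_ext _ _, hI.hom_ext _ _⟩

instance : HasInitial (Presheaf C) :=
  (vacuous_of_vacuous_obj (X := empty C) ⟨initialIsInitial⟩).some.hasInitial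

end Empty

/-! ## Pullbacks of presheaves -/

variable [HasFiniteLimits E]

/-- Pullbacks of presheaves are computed on underlying objects. -/
theorem exists_isPullback {X Y Z : Presheaf C} (f : X ⟶ Z) (g : Y ⟶ Z) :
    ∃ (P : Presheaf C) (p : P ⟶ X) (q : P ⟶ Y),
      IsPullback p q f g ∧ IsPullback (Hom.hom p) (Hom.hom q) (Hom.hom f) (Hom.hom g) := by
  let i : pullback (Hom.hom f) (Hom.hom g) ⟶ (prod X Y).obj :=
    pullback.lift (pullback.fst _ _) (pullback.snd _ _) (by
      rw [← hom_proj f, pullback.condition_assoc, hom_proj])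
  have h₁ : i ≫ Hom.hom (fst X Y) = pullback.fst _ _ := pullback.lift_fst _ _ _
  have h₂ : i ≫ Hom.hom (snd X Y) = pullback.snd _ _ := pullback.lift_snd _ _ _
  have : Mono i := ⟨fun s t e => by
    apply pullback.hom_ext
    · rw [← h₁, reassoc_of% e]
    · rw [← h₂, reassoc_of% e]⟩
  let P : Presheaf C := (prod X Y).sub i fun {T} t k h => by
    refine ⟨pullback.lift ((prod X Y).act (t ≫ i) k h ≫ Hom.hom (fst X Y))
      ((prod X Y).act (t ≫ i) k h ≫ Hom.hom (snd X Y)) ?_, ?_⟩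
    · rw [act_hom, act_hom, act_hom, act_hom]
      exact act_congr _ (by
        simp only [Category.assoc, reassoc_of% h₁, reassoc_of% h₂, pullback.condition]) rfl _
    · apply pullback.hom_ext
      · refine (Category.assoc _ _ _).trans ?_
        exact (congrArg _ h₁).trans (pullback.lift_fst _ _ _)
      · refine (Category.assoc _ _ _).trans ?_
        exact (congrArg _ h₂).trans (pullback.lift_snd _ _ _)
  let ι : P ⟶ prod X Y := (prod X Y).subι i _
  have hP : IsPullback (Hom.hom (ι ≫ fst X Y)) (Hom.hom (ι ≫ snd X Y)) (Hom.hom f) (Hom.hom g) := by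
    have e₁ : Hom.hom (ι ≫ fst X Y) = pullback.fst _ _ := h₁
    have e₂ : Hom.hom (ι ≫ snd X Y) = pullback.snd _ _ := h₂
    rw [e₁, e₂]
    exact IsPullback.of_hasPullback _ _
  exact ⟨P, _, _, isPullback_of_hom hP, hP⟩

instance : HasPullbacks (Presheaf C) :=
  have (X Y Z : Presheaf C) (f : X ⟶ Z) (g : Y ⟶ Z) : HasLimit (cospan f g) := by
    obtain ⟨_, _, _, h, -⟩ := exists_isPullback f g
    exact h.hasPullback
  hasPullbacks_of_hasLimit_cospan _

theorem isPullback_hom {P X Y Z : Presheaf C} {p : P ⟶ X} {q : P ⟶ Y} {f : X ⟶ Z} {g : Y ⟶ Z}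
    (h : IsPullback p q f g) :
    IsPullback (Hom.hom p) (Hom.hom q) (Hom.hom f) (Hom.hom g) := by
  obtain ⟨P', p', q', h', h''⟩ := exists_isPullback f g
  let e := h.isoIsPullback _ _ h'
  refine h''.of_iso ⟨Hom.hom e.inv, Hom.hom e.hom, congrArg Hom.hom e.inv_hom_id,
    congrArg Hom.hom e.hom_inv_id⟩ (Iso.refl _) (Iso.refl _) (Iso.refl _) ?_ ?_ ?_ ?_
  · exact (Category.comp_id _).trans (congrArg Hom.hom (h.isoIsPullback_inv_fst _ _ h')).symm
  · exact (Category.comp_id _).trans (congrArg Hom.hom (h.isoIsPullback_inv_snd _ _ h')).symm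
  · simp
  · simp

variable [HasInitial E] [HasStrictInitialObjects E]

theorem disjointOver_iff {X Y A : Presheaf C} (f : X ⟶ Y) (a : A ⟶ Y) :
    DisjointOver f a ↔ DisjointOver (Hom.hom f) (Hom.hom a) := by
  obtain ⟨P, p, q, h, h'⟩ := exists_isPullback f a
  rw [disjointOver_iff_of_isPullback h, disjointOver_iff_of_isPullback h']
  exact ⟨vacuous_obj, vacuous_of_vacuous_obj⟩

theorem isPseudocomplement_of_hom {X Y N : Presheaf C} {f : X ⟶ Y} {n : N ⟶ Y}
    (h : IsPseudocomplement (Hom.hom f) (Hom.hom n)) : IsPseudocomplement f n := by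
  have := h.mono
  refine ⟨mono_of_mono_hom n, fun a => ?_⟩
  rw [disjointOver_iff, ← h.factors_iff]
  exact ⟨fun ⟨t, ht⟩ => ⟨Hom.hom t, congrArg Hom.hom ht⟩,
    fun ⟨t, ht⟩ => ⟨factor a n t ht, factor_comp a n t ht⟩⟩

/-- If `f` restricts emptiness, its negation is computed on underlying objects. -/
theorem RestrictsEmptiness.isPseudocomplement_hom [LocallyCartesianClosed E] {X Y N : Presheaf C}
    {f : X ⟶ Y} {n : N ⟶ Y} (hf : RestrictsEmptiness f) (hn : IsPseudocomplement f n) :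
    IsPseudocomplement (Hom.hom f) (Hom.hom n) := by
  obtain ⟨M, i, hi⟩ := exists_isPseudocomplement (Hom.hom f)
  have := hi.mono
  have hcl : ∀ {T : E} (t : T ⟶ M) (g : T ⟶ C.Mor) (h : (t ≫ i) ≫ Y.proj = g ≫ C.tgt),
      ∃ r : T ⟶ M, r ≫ i = Y.act (t ≫ i) g h :=
    -- Closure of the objectwise negation under restriction is exactly the hypothesis `hf`.
    fun t g h => (hi.factors_iff _).2 (hf _ g h (hi.disjoint.precomp t))
  have hs : IsPseudocomplement f (Y.subι i hcl) := isPseudocomplement_of_hom hi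
  obtain ⟨e, he⟩ := hn.exists_iso hs
  exact hi.of_iso ⟨Hom.hom e.hom, Hom.hom e.inv, congrArg Hom.hom e.hom_inv_id,
    congrArg Hom.hom e.inv_hom_id⟩ (congrArg Hom.hom he)

end Presheaf

/-! ### Generalized elements of internal presheaves -/

section Cubes

variable {E : Type u} [Category.{v} E]

theorem InternalCategory.comp_congr (C : InternalCategory E) {T : E} {f f' g g' : T ⟶ C.Mor}
    (hf : f = f') (hg : g = g') (h : f ≫ C.tgt = g ≫ C.src) :
    C.comp f g h = C.comp f' g' (by rw [← hf, ← hg, h]) := by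
  subst hf; subst hg; rfl

namespace Presheaf

theorem act_eq_act_comp {C : InternalCategory E} (X : Presheaf C) {T : E} {x y : T ⟶ X.obj}
    {g : T ⟶ C.Mor} {hg : x ≫ X.proj = g ≫ C.tgt} (hy : y = X.act x g hg) (f : T ⟶ C.Mor)
    (hf : y ≫ X.proj = f ≫ C.tgt) :
    X.act y f hf = X.act x
      (C.comp f g (by rw [← hf, hy, X.act_proj])) (by rw [C.comp_tgt, hg]) := by
  subst hy
  exact X.act_comp x f g _ hg

theorem hom_ext_of_comp {C : InternalCategory E} {X Y : Presheaf C} {u w : X ⟶ Y}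
    (h : ∀ {T : E} (x : T ⟶ X.obj), x ≫ Hom.hom u = x ≫ Hom.hom w) : u = w :=
  hom_ext (by simpa using h (𝟙 X.obj))

/-- A morphism of presheaves, described on generalized elements. -/
structure ElementwiseHom {C : InternalCategory E} (X Y : Presheaf C) where
  app : ∀ {T : E}, (T ⟶ X.obj) → (T ⟶ Y.obj)
  natural : ∀ {S T : E} (s : S ⟶ T) (x : T ⟶ X.obj), s ≫ app x = app (s ≫ x)
  proj : ∀ {T : E} (x : T ⟶ X.obj), app x ≫ Y.proj = x ≫ X.proj
  act : ∀ {T : E} (x : T ⟶ X.obj) (f : T ⟶ C.Mor) (h : x ≫ X.proj = f ≫ C.tgt),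
    app (X.act x f h) = Y.act (app x) f ((proj x).trans h)

namespace ElementwiseHom

variable {C : InternalCategory E} {X Y : Presheaf C} (φ : ElementwiseHom X Y)

/-- The morphism of presheaves described by `φ`. -/
def toHom : X ⟶ Y where
  hom := φ.app (𝟙 X.obj)
  hom_proj := (φ.proj _).trans (Category.id_comp _)
  act_hom x f h := by
    rw [φ.natural, Category.comp_id, φ.act]
    exact Y.act_congr (by rw [φ.natural, Category.comp_id]) rfl _

theorem comp_toHom {T : E} (x : T ⟶ X.obj) : x ≫ Hom.hom φ.toHom = φ.app x :=
  (φ.natural x _).trans (congrArg φ.app (Category.comp_id x))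

end ElementwiseHom

end Presheaf

variable [HasFiniteLimits E]

/-! ## Families of representable presheaves -/

namespace Presheaf

/-- The family of representable presheaves indexed by `c : T ⟶ C.Ob`, as a presheaf over `Δ T`. -/
def family (C : InternalCategory E) {T : E} (c : T ⟶ C.Ob) : Presheaf C where
  obj := pullback C.tgt c
  proj := pullback.fst C.tgt c ≫ C.src
  act x f h := pullback.lift
    (C.comp f (x ≫ pullback.fst C.tgt c) (by simpa using h.symm))
    (x ≫ pullback.snd C.tgt c)
    (by rw [C.comp_tgt, Category.assoc, Category.assoc, pullback.condition])
  act_natural s x f h := by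
    apply pullback.hom_ext
    · simp only [Category.assoc, pullback.lift_fst, C.comp_natural]
    · simp only [Category.assoc, pullback.lift_snd]
  act_proj x f h := by
    rw [← Category.assoc, pullback.lift_fst, C.comp_src]
  act_ident x := by
    apply pullback.hom_ext
    · rw [pullback.lift_fst]
      have := C.ident_comp (x ≫ pullback.fst C.tgt c)
      simpa only [Category.assoc] using this
    · rw [pullback.lift_snd]
  act_comp x f g h hx := by
    apply pullback.hom_ext
    · simp only [pullback.lift_fst]
      rw [C.assoc]
    · simp only [pullback.lift_snd]

variable {C : InternalCategory E} {T : E}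

/-- The underlying map of an element of a family of representables. -/
def familyMap (c : T ⟶ C.Ob) : (family C c).obj ⟶ C.Mor := pullback.fst C.tgt c

/-- The index of an element of a family of representables. -/
def familyParam (c : T ⟶ C.Ob) : (family C c).obj ⟶ T := pullback.snd C.tgt c

theorem familyMap_src (c : T ⟶ C.Ob) : familyMap c ≫ C.src = (family C c).proj := rfl

theorem familyMap_tgt (c : T ⟶ C.Ob) : familyMap c ≫ C.tgt = familyParam c ≫ c :=
  pullback.condition

/-- The element of a family of representables with the given map and index. -/
def familyMk {S : E} (c : T ⟶ C.Ob) (f : S ⟶ C.Mor) (t : S ⟶ T) (h : f ≫ C.tgt = t ≫ c) :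
    S ⟶ (family C c).obj := pullback.lift f t h

theorem familyMk_map {S : E} (c : T ⟶ C.Ob) (f : S ⟶ C.Mor) (t : S ⟶ T)
    (h : f ≫ C.tgt = t ≫ c) : familyMk c f t h ≫ familyMap c = f := pullback.lift_fst _ _ _

theorem familyMk_param {S : E} (c : T ⟶ C.Ob) (f : S ⟶ C.Mor) (t : S ⟶ T)
    (h : f ≫ C.tgt = t ≫ c) : familyMk c f t h ≫ familyParam c = t := pullback.lift_snd _ _ _

theorem act_familyMap {S : E} (c : T ⟶ C.Ob) (x : S ⟶ (family C c).obj) (f : S ⟶ C.Mor)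
    (h : x ≫ (family C c).proj = f ≫ C.tgt) :
    (family C c).act x f h ≫ familyMap c =
      C.comp f (x ≫ familyMap c) (by rw [Category.assoc, familyMap_src, h]) :=
  pullback.lift_fst _ _ _

theorem act_familyParam {S : E} (c : T ⟶ C.Ob) (x : S ⟶ (family C c).obj) (f : S ⟶ C.Mor)
    (h : x ≫ (family C c).proj = f ≫ C.tgt) :
    (family C c).act x f h ≫ familyParam c = x ≫ familyParam c :=
  pullback.lift_snd _ _ _

theorem family_ext {S : E} {c : T ⟶ C.Ob} {x y : S ⟶ (family C c).obj}
    (h₁ : x ≫ familyMap c = y ≫ familyMap c) (h₂ : x ≫ familyParam c = y ≫ familyParam c) :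
    x = y :=
  pullback.hom_ext h₁ h₂

theorem comp_familyMap_src {S : E} {c : T ⟶ C.Ob} (x : S ⟶ (family C c).obj) :
    (x ≫ familyMap c) ≫ C.src = x ≫ (family C c).proj :=
  Category.assoc _ _ _

theorem comp_familyMap_tgt {S : E} {c : T ⟶ C.Ob} (x : S ⟶ (family C c).obj) :
    (x ≫ familyMap c) ≫ C.tgt = (x ≫ familyParam c) ≫ c := by
  rw [Category.assoc, Category.assoc, familyMap_tgt]

theorem familyMk_proj {S : E} (c : T ⟶ C.Ob) (f : S ⟶ C.Mor) (t : S ⟶ T)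
    (h : f ≫ C.tgt = t ≫ c) : familyMk c f t h ≫ (family C c).proj = f ≫ C.src := by
  rw [← comp_familyMap_src, familyMk_map]

theorem familyMk_congr {S : E} {c : T ⟶ C.Ob} {f f' : S ⟶ C.Mor} {t t' : S ⟶ T} (hf : f = f')
    (ht : t = t') (h : f ≫ C.tgt = t ≫ c) :
    familyMk c f t h = familyMk c f' t' (by rw [← hf, ← ht, h]) := by
  subst hf; subst ht; rfl

theorem comp_familyMk {S S' : E} (s : S' ⟶ S) (c : T ⟶ C.Ob) (f : S ⟶ C.Mor) (t : S ⟶ T)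
    (h : f ≫ C.tgt = t ≫ c) :
    s ≫ familyMk c f t h = familyMk c (s ≫ f) (s ≫ t) (by simp [h]) := by
  apply family_ext
  · rw [Category.assoc, familyMk_map, familyMk_map]
  · rw [Category.assoc, familyMk_param, familyMk_param]

theorem act_familyMk {S : E} (c : T ⟶ C.Ob) (f : S ⟶ C.Mor) (t : S ⟶ T)
    (h : f ≫ C.tgt = t ≫ c) (g : S ⟶ C.Mor)
    (hg : familyMk c f t h ≫ (family C c).proj = g ≫ C.tgt) :
    (family C c).act (familyMk c f t h) g hg =
      familyMk c (C.comp g f (by rw [← hg, familyMk_proj])) t (by rw [C.comp_tgt, h]) := by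
  apply family_ext
  · exact (act_familyMap _ _ _ _).trans
      ((C.comp_congr rfl (familyMk_map _ _ _ _) _).trans (familyMk_map _ _ _ _).symm)
  · rw [act_familyParam, familyMk_param, familyMk_param]

/-- The elementwise description of `ofElement`. -/
def ofElementElementwise (X : Presheaf C) (c : T ⟶ C.Ob) (x : T ⟶ X.obj) (hx : x ≫ X.proj = c) :
    ElementwiseHom (family C c) X where
  app z := X.act ((z ≫ familyParam c) ≫ x) (z ≫ familyMap c) (by
    rw [Category.assoc, hx, comp_familyMap_tgt])
  natural s z := (X.act_natural _ _ _ _).trans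
    (X.act_congr (by simp only [Category.assoc]) (by simp only [Category.assoc]) _)
  proj z := (X.act_proj _ _ _).trans (comp_familyMap_src z)
  act z f h := Eq.trans (X.act_congr (by rw [act_familyParam]) (act_familyMap c z f h) _)
    (X.act_eq_act_comp rfl f _).symm

/-- The map out of a family of representables that corresponds to an element of `X` by the Yoneda
lemma. -/
def ofElement (X : Presheaf C) (c : T ⟶ C.Ob) (x : T ⟶ X.obj) (hx : x ≫ X.proj = c) :
    family C c ⟶ X :=
  (ofElementElementwise X c x hx).toHom

theorem comp_ofElement (X : Presheaf C) (c : T ⟶ C.Ob) (x : T ⟶ X.obj) (hx : x ≫ X.proj = c)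
    {S : E} (z : S ⟶ (family C c).obj) :
    z ≫ Hom.hom (ofElement X c x hx) = X.act ((z ≫ familyParam c) ≫ x) (z ≫ familyMap c) (by
      rw [Category.assoc, hx, comp_familyMap_tgt]) :=
  (ofElementElementwise X c x hx).comp_toHom z

/-! ## Constant presheaves and products -/

/-- The element of `T` underlying an element of `Δ T`. -/
def constVal (C : InternalCategory E) (T : E) : ((const C).obj T).obj ⟶ T := Limits.prod.fst

/-- The element of `Δ T` at the stage `c` given by `t`. -/
def constMk {S : E} (t : S ⟶ T) (c : S ⟶ C.Ob) : S ⟶ ((const C).obj T).obj := Limits.prod.lift t c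

theorem constMk_val {S : E} (t : S ⟶ T) (c : S ⟶ C.Ob) : constMk t c ≫ constVal C T = t :=
  Limits.prod.lift_fst _ _

theorem constMk_proj {S : E} (t : S ⟶ T) (c : S ⟶ C.Ob) :
    constMk t c ≫ ((const C).obj T).proj = c :=
  Limits.prod.lift_snd _ _

theorem const_ext {S : E} {x y : S ⟶ ((const C).obj T).obj}
    (h₁ : x ≫ constVal C T = y ≫ constVal C T)
    (h₂ : x ≫ ((const C).obj T).proj = y ≫ ((const C).obj T).proj) : x = y :=
  Limits.prod.hom_ext h₁ h₂

theorem act_constVal {S : E} (x : S ⟶ ((const C).obj T).obj) (f : S ⟶ C.Mor)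
    (h : x ≫ ((const C).obj T).proj = f ≫ C.tgt) :
    ((const C).obj T).act x f h ≫ constVal C T = x ≫ constVal C T :=
  Limits.prod.lift_fst _ _

theorem const_map_val {S : E} (u : S ⟶ T) :
    Hom.hom ((const C).map u) ≫ constVal C T = constVal C S ≫ u :=
  Limits.prod.map_fst _ _

/-- Maps to a constant presheaf are given by maps to its value that are invariant under
restriction. -/
def toConst (X : Presheaf C) (u : X.obj ⟶ T)
    (hu : ∀ {S : E} (x : S ⟶ X.obj) (f : S ⟶ C.Mor) (h : x ≫ X.proj = f ≫ C.tgt),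
      X.act x f h ≫ u = x ≫ u) : X ⟶ (const C).obj T where
  hom := constMk u X.proj
  hom_proj := constMk_proj _ _
  act_hom x f h := by
    apply const_ext
    · rw [act_constVal, Category.assoc, Category.assoc, constMk_val, hu]
    · rw [Presheaf.act_proj, Category.assoc, constMk_proj, X.act_proj]

theorem toConst_val (X : Presheaf C) (u : X.obj ⟶ T)
    (hu : ∀ {S : E} (x : S ⟶ X.obj) (f : S ⟶ C.Mor) (h : x ≫ X.proj = f ≫ C.tgt),
      X.act x f h ≫ u = x ≫ u) : Hom.hom (X.toConst u hu) ≫ constVal C T = u :=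
  constMk_val _ _

theorem hom_toConst_ext {X : Presheaf C} {u w : X ⟶ (const C).obj T}
    (h : Hom.hom u ≫ constVal C T = Hom.hom w ≫ constVal C T) : u = w :=
  hom_ext (const_ext h ((hom_proj u).trans (hom_proj w).symm))

/-- A family of representables lies over the constant presheaf of its indices. -/
def familyIndex (c : T ⟶ C.Ob) : family C c ⟶ (const C).obj T :=
  toConst _ (familyParam c) fun x f h => act_familyParam c x f h

theorem familyIndex_val (c : T ⟶ C.Ob) :
    Hom.hom (familyIndex c) ≫ constVal C T = familyParam c :=
  toConst_val _ _ _

/-- The element of a product with given components. -/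
def prodMk {X Y : Presheaf C} {S : E} (x : S ⟶ X.obj) (y : S ⟶ Y.obj)
    (h : x ≫ X.proj = y ≫ Y.proj) : S ⟶ (prod X Y).obj :=
  pullback.lift x y h

theorem prodMk_fst {X Y : Presheaf C} {S : E} (x : S ⟶ X.obj) (y : S ⟶ Y.obj)
    (h : x ≫ X.proj = y ≫ Y.proj) : prodMk x y h ≫ Hom.hom (fst X Y) = x :=
  pullback.lift_fst _ _ _

theorem prodMk_snd {X Y : Presheaf C} {S : E} (x : S ⟶ X.obj) (y : S ⟶ Y.obj)
    (h : x ≫ X.proj = y ≫ Y.proj) : prodMk x y h ≫ Hom.hom (snd X Y) = y :=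
  pullback.lift_snd _ _ _

theorem lift_fst {X Y Z : Presheaf C} (x : Z ⟶ X) (y : Z ⟶ Y) : lift x y ≫ fst X Y = x :=
  hom_ext (pullback.lift_fst _ _ _)

theorem lift_snd {X Y Z : Presheaf C} (x : Z ⟶ X) (y : Z ⟶ Y) : lift x y ≫ snd X Y = y :=
  hom_ext (pullback.lift_snd _ _ _)

end Presheaf

/-! ## Points and pairs in a category of cubes -/

namespace CubeCategory

variable {ℕE : NaturalNumbersObject E} (B : CubeCategory ℕE) {S T : E}

/-- The map to the terminal cube. -/
def bang (c : T ⟶ B.Ob) : T ⟶ B.Mor := (B.existsUnique_to_pt c).choose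

theorem bang_src (c : T ⟶ B.Ob) : B.bang c ≫ B.src = c := (B.existsUnique_to_pt c).choose_spec.1.1

theorem bang_tgt (c : T ⟶ B.Ob) : B.bang c ≫ B.tgt = terminal.from T ≫ B.pt :=
  (B.existsUnique_to_pt c).choose_spec.1.2

theorem to_pt_ext {f g : T ⟶ B.Mor} (h : f ≫ B.src = g ≫ B.src)
    (hf : f ≫ B.tgt = terminal.from T ≫ B.pt) (hg : g ≫ B.tgt = terminal.from T ≫ B.pt) : f = g :=
  (B.existsUnique_to_pt (g ≫ B.src)).unique ⟨h, hf⟩ ⟨rfl, hg⟩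

theorem terminal_from_natural (s : S ⟶ T) {X : E} (p : ⊤_ E ⟶ X) :
    s ≫ terminal.from T ≫ p = terminal.from S ≫ p := by
  rw [← Category.assoc, terminal.comp_from]

/-- The pairing of two maps of cubes with the same source. -/
def pair (f g : T ⟶ B.Mor) (h : f ≫ B.src = g ≫ B.src) : T ⟶ B.Mor :=
  (B.existsUnique_lift f g h).choose

theorem pair_isComp (f g : T ⟶ B.Mor) (h : f ≫ B.src = g ≫ B.src) :
    B.IsComp (B.pair f g h) (Limits.prod.lift (f ≫ B.tgt) (g ≫ B.tgt) ≫ B.prodFst) f ∧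
      B.IsComp (B.pair f g h) (Limits.prod.lift (f ≫ B.tgt) (g ≫ B.tgt) ≫ B.prodSnd) g :=
  (B.existsUnique_lift f g h).choose_spec.1

theorem eq_pair {f g : T ⟶ B.Mor} (h : f ≫ B.src = g ≫ B.src) {k : T ⟶ B.Mor}
    (h₁ : B.IsComp k (Limits.prod.lift (f ≫ B.tgt) (g ≫ B.tgt) ≫ B.prodFst) f)
    (h₂ : B.IsComp k (Limits.prod.lift (f ≫ B.tgt) (g ≫ B.tgt) ≫ B.prodSnd) g) :
    k = B.pair f g h :=
  (B.existsUnique_lift f g h).unique ⟨h₁, h₂⟩ (B.pair_isComp f g h)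

theorem pair_src (f g : T ⟶ B.Mor) (h : f ≫ B.src = g ≫ B.src) :
    B.pair f g h ≫ B.src = f ≫ B.src := by
  obtain ⟨h₁, h₂⟩ := (B.pair_isComp f g h).1
  rw [← B.comp_src _ _ h₁, h₂]

theorem pair_tgt (f g : T ⟶ B.Mor) (h : f ≫ B.src = g ≫ B.src) :
    B.pair f g h ≫ B.tgt = Limits.prod.lift (f ≫ B.tgt) (g ≫ B.tgt) ≫ B.prodOb := by
  obtain ⟨h₁, -⟩ := (B.pair_isComp f g h).1
  rw [h₁, Category.assoc, B.prodFst_src]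

theorem pair_congr {f f' g g' : T ⟶ B.Mor} (hf : f = f') (hg : g = g')
    (h : f ≫ B.src = g ≫ B.src) : B.pair f g h = B.pair f' g' (by rw [← hf, ← hg, h]) := by
  subst hf; subst hg; rfl

theorem pair_natural (s : S ⟶ T) (f g : T ⟶ B.Mor) (h : f ≫ B.src = g ≫ B.src) :
    s ≫ B.pair f g h = B.pair (s ≫ f) (s ≫ g) (by simp [h]) := by
  obtain ⟨⟨h₁, h₁'⟩, ⟨h₂, h₂'⟩⟩ := B.pair_isComp f g h
  have key : Limits.prod.lift ((s ≫ f) ≫ B.tgt) ((s ≫ g) ≫ B.tgt) =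
      s ≫ Limits.prod.lift (f ≫ B.tgt) (g ≫ B.tgt) := by 
    simp only [Limits.prod.comp_lift, Category.assoc]
  apply B.eq_pair
  · refine ⟨by rw [key, Category.assoc, h₁]; simp only [Category.assoc], ?_⟩
    refine (B.comp_congr rfl (by rw [key, Category.assoc]) _).trans
      ((B.comp_natural s _ _ h₁).symm.trans (by rw [h₁']))
  · refine ⟨by rw [key, Category.assoc, h₂]; simp only [Category.assoc], ?_⟩
    refine (B.comp_congr rfl (by rw [key, Category.assoc]) _).trans
      ((B.comp_natural s _ _ h₂).symm.trans (by rw [h₂']))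

theorem comp_pair (k f g : T ⟶ B.Mor) (h : f ≫ B.src = g ≫ B.src) (hk : k ≫ B.tgt = f ≫ B.src) :
    B.comp k (B.pair f g h) (by rw [pair_src, hk]) =
      B.pair (B.comp k f hk) (B.comp k g (hk.trans h)) (by rw [B.comp_src, B.comp_src]) := by
  obtain ⟨⟨h₁, h₁'⟩, ⟨h₂, h₂'⟩⟩ := B.pair_isComp f g h
  apply B.eq_pair
  · refine ⟨by rw [B.comp_tgt, B.comp_tgt, B.comp_tgt, h₁], ?_⟩
    refine (B.comp_congr rfl (by rw [B.comp_tgt, B.comp_tgt]) _).trans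
      ((B.assoc _ _ _ _ h₁).trans ?_)
    exact B.comp_congr rfl h₁' _
  · refine ⟨by rw [B.comp_tgt, B.comp_tgt, B.comp_tgt, h₂], ?_⟩
    refine (B.comp_congr rfl (by rw [B.comp_tgt, B.comp_tgt]) _).trans
      ((B.assoc _ _ _ _ h₂).trans ?_)
    exact B.comp_congr rfl h₂' _

/-- Pairing the two projections gives the identity. In `exists_transport` this identifies the
generic element of `y (c × I)`, at which the lift is evaluated. -/
theorem pair_fst_snd (c d : T ⟶ B.Ob) :
    B.pair (Limits.prod.lift c d ≫ B.prodFst) (Limits.prod.lift c d ≫ B.prodSnd)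
        (by simp [B.prodFst_src, B.prodSnd_src]) = (Limits.prod.lift c d ≫ B.prodOb) ≫ B.ident := by
  have key : Limits.prod.lift ((Limits.prod.lift c d ≫ B.prodFst) ≫ B.tgt)
      ((Limits.prod.lift c d ≫ B.prodSnd) ≫ B.tgt) = Limits.prod.lift c d := by
    apply Limits.prod.hom_ext
    · rw [Limits.prod.lift_fst, Category.assoc, B.prodFst_tgt]
    · rw [Limits.prod.lift_snd, Category.assoc, B.prodSnd_tgt]
  symm
  apply B.eq_pair
  · refine ⟨by rw [key]; simp [B.ident_tgt, B.prodFst_src], ?_⟩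
    refine (B.comp_congr ?_ (by rw [key]) _).trans (B.ident_comp _)
    simp [reassoc_of% B.prodFst_src]
  · refine ⟨by rw [key]; simp [B.ident_tgt, B.prodSnd_src], ?_⟩
    refine (B.comp_congr ?_ (by rw [key]) _).trans (B.ident_comp _)
    simp [reassoc_of% B.prodSnd_src]

/-- The constant map `c ⟶ d` at a point `p` of `d`. -/
def constMap (c : T ⟶ B.Ob) (p : T ⟶ B.Mor) (hp : p ≫ B.src = terminal.from T ≫ B.pt) :
    T ⟶ B.Mor :=
  B.comp (B.bang c) p (by rw [bang_tgt, hp])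

variable {B} in
theorem constMap_src (c : T ⟶ B.Ob) {p : T ⟶ B.Mor} (hp : p ≫ B.src = terminal.from T ≫ B.pt) :
    B.constMap c p hp ≫ B.src = c := by
  rw [constMap, B.comp_src, bang_src]

variable {B} in
theorem constMap_tgt (c : T ⟶ B.Ob) {p : T ⟶ B.Mor} (hp : p ≫ B.src = terminal.from T ≫ B.pt) :
    B.constMap c p hp ≫ B.tgt = p ≫ B.tgt := by
  rw [constMap, B.comp_tgt]

variable {B} in
theorem comp_constMap (k : T ⟶ B.Mor) (c : T ⟶ B.Ob) {p : T ⟶ B.Mor}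
    (hp : p ≫ B.src = terminal.from T ≫ B.pt) (hk : k ≫ B.tgt = c) :
    B.comp k (B.constMap c p hp) (by rw [constMap_src, hk]) = B.constMap (k ≫ B.src) p hp := by
  refine (B.assoc _ _ _ (by rw [bang_src, hk]) (by rw [bang_tgt, hp])).symm.trans
    (B.comp_congr (B.to_pt_ext ?_ ?_ ?_) rfl _)
  · rw [B.comp_src, bang_src]
  · rw [B.comp_tgt, bang_tgt]
  · rw [bang_tgt]

variable {B} in
theorem constMap_natural (s : S ⟶ T) (c : T ⟶ B.Ob) {p : T ⟶ B.Mor}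
    (hp : p ≫ B.src = terminal.from T ≫ B.pt) :
    s ≫ B.constMap c p hp = B.constMap (s ≫ c) (s ≫ p)
      (by rw [Category.assoc, hp, terminal_from_natural]) := by
  refine (B.comp_natural s _ _ _).trans (B.comp_congr (B.to_pt_ext ?_ ?_ ?_) rfl _)
  · rw [Category.assoc, bang_src, bang_src]
  · rw [Category.assoc, bang_tgt, terminal_from_natural]
  · rw [bang_tgt]

/-- The constant map at a point of `c` is constant when it is restricted to the terminal cube. -/
theorem constMap_pt {p : T ⟶ B.Mor} (hp : p ≫ B.src = terminal.from T ≫ B.pt) :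
    B.constMap (p ≫ B.src) p hp = p := by
  refine (B.comp_congr (B.to_pt_ext ?_ ?_ ?_) rfl _).trans (B.ident_comp p)
  · rw [bang_src, Category.assoc, Category.assoc, B.ident_src, Category.comp_id]
  · rw [bang_tgt]
  · rw [Category.assoc, Category.assoc, B.ident_tgt, Category.comp_id, hp]

end CubeCategory

/-! ## Transport along the interval -/

namespace CubeCategory

open Presheaf

variable {ℕE : NaturalNumbersObject E} (B : CubeCategory ℕE) {S T : E}

variable {B} in
theorem constMap_congr {c c' : T ⟶ B.Ob} {p p' : T ⟶ B.Mor} (hc : c = c') (h : p = p')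
    (hp : p ≫ B.src = terminal.from T ≫ B.pt) :
    B.constMap c p hp = B.constMap c' p' (by rw [← h, hp]) := by
  subst hc; subst h; rfl

/-- The elementwise description of `pointMap`. -/
def pointMapElementwise (p : T ⟶ B.Mor) (hp : p ≫ B.src = terminal.from T ≫ B.pt)
    (hp' : p ≫ B.tgt = terminal.from T ≫ B.interval) :
    ElementwiseHom (B.Δ.obj T) (family B.toInternalCategory B.interval) where
  app {S} x := familyMk B.interval
      (B.constMap (x ≫ (B.Δ.obj T).proj) ((x ≫ constVal _ T) ≫ p)
        (by rw [Category.assoc, hp, terminal_from_natural]))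
      (terminal.from S) (by rw [constMap_tgt, Category.assoc, hp', terminal_from_natural])
  natural s x := (comp_familyMk _ _ _ _ _).trans (familyMk_congr ((constMap_natural _ _ _).trans
    (constMap_congr (by simp only [Category.assoc]) (by simp only [Category.assoc]) _))
    (Subsingleton.elim _ _) _)
  proj x := (familyMk_proj _ _ _ _).trans (constMap_src _ _)
  act x f h := Eq.trans (familyMk_congr (Eq.trans (constMap_congr ((B.Δ.obj T).act_proj _ _ _)
    (by rw [act_constVal]) _) (comp_constMap _ _ _ h.symm).symm) rfl _)
    (act_familyMk _ _ _ _ _ _).symm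

/-- The family of points of `y I` given by a family of maps from the terminal cube to `I`. -/
def pointMap (p : T ⟶ B.Mor) (hp : p ≫ B.src = terminal.from T ≫ B.pt)
    (hp' : p ≫ B.tgt = terminal.from T ≫ B.interval) : B.Δ.obj T ⟶ B.yI :=
  (B.pointMapElementwise p hp hp').toHom

theorem comp_pointMap (p : T ⟶ B.Mor) (hp : p ≫ B.src = terminal.from T ≫ B.pt)
    (hp' : p ≫ B.tgt = terminal.from T ≫ B.interval) (x : S ⟶ (B.Δ.obj T).obj) :
    (x ≫ Hom.hom (B.pointMap p hp hp')) ≫ familyMap B.interval =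
      B.constMap (x ≫ (B.Δ.obj T).proj) ((x ≫ constVal _ T) ≫ p)
        (by rw [Category.assoc, hp, terminal_from_natural]) :=
  (congrArg (· ≫ familyMap B.interval) ((B.pointMapElementwise p hp hp').comp_toHom x)).trans
    (familyMk_map _ _ _ _)

/-- The product of a family of cubes with the interval. -/
def prodInterval (c : T ⟶ B.Ob) : T ⟶ B.Ob :=
  Limits.prod.lift c (terminal.from T ≫ B.interval) ≫ B.prodOb

theorem prodInterval_natural (s : S ⟶ T) (c : T ⟶ B.Ob) :
    s ≫ B.prodInterval c = B.prodInterval (s ≫ c) := by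
  rw [prodInterval, prodInterval, ← Category.assoc, Limits.prod.comp_lift, terminal_from_natural]

theorem pair_tgt_prodInterval {f g : T ⟶ B.Mor} (h : f ≫ B.src = g ≫ B.src)
    (hg : g ≫ B.tgt = terminal.from T ≫ B.interval) :
    B.pair f g h ≫ B.tgt = B.prodInterval (f ≫ B.tgt) := by
  rw [pair_tgt, hg, prodInterval]

theorem comp_fst_interval_src {X : B.CSet} (x : S ⟶ (prod B.yI X).obj) :
    ((x ≫ Hom.hom (fst B.yI X)) ≫ familyMap B.interval) ≫ B.src = x ≫ (prod B.yI X).proj :=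
  (comp_familyMap_src _).trans
    ((Category.assoc _ _ _).trans (congrArg _ (hom_proj (fst B.yI X))))

theorem comp_fst_interval_tgt {X : B.CSet} (x : S ⟶ (prod B.yI X).obj) :
    ((x ≫ Hom.hom (fst B.yI X)) ≫ familyMap B.interval) ≫ B.tgt =
      terminal.from S ≫ B.interval :=
  (comp_familyMap_tgt _).trans (congrArg (· ≫ B.interval) (Subsingleton.elim _ _))

theorem act_fst_interval {X : B.CSet} (x : S ⟶ (prod B.yI X).obj) (f : S ⟶ B.Mor)
    (h : x ≫ (prod B.yI X).proj = f ≫ B.tgt) :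
    ((prod B.yI X).act x f h ≫ Hom.hom (fst B.yI X)) ≫ familyMap B.interval =
      B.comp f ((x ≫ Hom.hom (fst B.yI X)) ≫ familyMap B.interval)
        (by rw [comp_fst_interval_src, h]) :=
  (congrArg (· ≫ familyMap B.interval) (act_hom (fst B.yI X) x f h)).trans
    (act_familyMap B.interval _ _ _)

theorem comp_snd_family_src {Z : B.CSet} {c : T ⟶ B.Ob}
    (x : S ⟶ (prod Z (family B.toInternalCategory c)).obj) :
    ((x ≫ Hom.hom (snd Z _)) ≫ familyMap c) ≫ B.src =
      x ≫ (prod Z (family B.toInternalCategory c)).proj :=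
  (comp_familyMap_src _).trans ((Category.assoc _ _ _).trans (congrArg _ (hom_proj (snd Z _))))

/-- The elementwise description of `pairMap`. -/
def pairMapElementwise (c : T ⟶ B.Ob) : ElementwiseHom (prod B.yI (family B.toInternalCategory c))
    (family B.toInternalCategory (B.prodInterval c)) where
  app x := familyMk _
    (B.pair ((x ≫ Hom.hom (snd B.yI _)) ≫ familyMap c)
      ((x ≫ Hom.hom (fst B.yI _)) ≫ familyMap B.interval)
      ((B.comp_snd_family_src x).trans (B.comp_fst_interval_src x).symm))
    ((x ≫ Hom.hom (snd B.yI _)) ≫ familyParam c) (by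
      rw [pair_tgt_prodInterval _ _ (B.comp_fst_interval_tgt x), comp_familyMap_tgt,
        prodInterval_natural])
  natural s x := (comp_familyMk _ _ _ _ _).trans (familyMk_congr ((B.pair_natural _ _ _ _).trans
    (B.pair_congr (by simp only [Category.assoc]) ((Category.assoc _ _ _).symm.trans
      (congrArg (· ≫ familyMap B.interval) (Category.assoc _ _ _).symm)) _))
    (by simp only [Category.assoc]) _)
  proj x := (familyMk_proj _ _ _ _).trans ((B.pair_src _ _ _).trans (B.comp_snd_family_src x))
  act x f h := by
    have h₂ := act_hom (snd B.yI (family B.toInternalCategory c)) x f h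
    have e₂ := (congrArg (· ≫ familyMap c) h₂).trans (act_familyMap c _ _ _)
    have e₃ := (congrArg (· ≫ familyParam c) h₂).trans (act_familyParam c _ _ _)
    exact Eq.trans (familyMk_congr ((B.pair_congr e₂ (B.act_fst_interval x f h) _).trans
      (B.comp_pair _ _ _ _ (by rw [comp_snd_family_src, h])).symm) e₃ _)
      (act_familyMk _ _ _ _ _ _).symm

/-- Pairing, as a map from `y I × y c` to `y (c × I)`. -/
def pairMap (c : T ⟶ B.Ob) : prod B.yI (family B.toInternalCategory c) ⟶
    family B.toInternalCategory (B.prodInterval c) :=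
  (B.pairMapElementwise c).toHom

theorem comp_pairMap_map (c : T ⟶ B.Ob)
    (x : S ⟶ (prod B.yI (family B.toInternalCategory c)).obj) :
    (x ≫ Hom.hom (B.pairMap c)) ≫ familyMap _ =
      B.pair ((x ≫ Hom.hom (snd B.yI _)) ≫ familyMap c)
        ((x ≫ Hom.hom (fst B.yI _)) ≫ familyMap B.interval)
        ((B.comp_snd_family_src x).trans (B.comp_fst_interval_src x).symm) :=
  (congrArg (· ≫ familyMap _) ((B.pairMapElementwise c).comp_toHom x)).trans
    (familyMk_map _ _ _ _)

theorem comp_pairMap_param (c : T ⟶ B.Ob)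
    (x : S ⟶ (prod B.yI (family B.toInternalCategory c)).obj) :
    (x ≫ Hom.hom (B.pairMap c)) ≫ familyParam _ = (x ≫ Hom.hom (snd B.yI _)) ≫ familyParam c :=
  (congrArg (· ≫ familyParam _) ((B.pairMapElementwise c).comp_toHom x)).trans
    (familyMk_param _ _ _ _)

end CubeCategory

/-! ### Faces of cubes and extension from a face -/

namespace CubeCategory

open Presheaf

variable {ℕE : NaturalNumbersObject E} (B : CubeCategory ℕE) {S T : E}

/-- The inclusion `c ⟶ c × I` at a point `p` of `I`. -/
def faceMap (c : T ⟶ B.Ob) (p : T ⟶ B.Mor) (hp : p ≫ B.src = terminal.from T ≫ B.pt) :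
    T ⟶ B.Mor :=
  B.pair (c ≫ B.ident) (B.constMap c p hp)
    (by rw [Category.assoc, B.ident_src, Category.comp_id, constMap_src])

variable {B}

theorem faceMap_src (c : T ⟶ B.Ob) {p : T ⟶ B.Mor} (hp : p ≫ B.src = terminal.from T ≫ B.pt) :
    B.faceMap c p hp ≫ B.src = c := by
  rw [faceMap, pair_src, Category.assoc, B.ident_src, Category.comp_id]

theorem faceMap_tgt (c : T ⟶ B.Ob) {p : T ⟶ B.Mor} (hp : p ≫ B.src = terminal.from T ≫ B.pt)
    (hp' : p ≫ B.tgt = terminal.from T ≫ B.interval) :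
    B.faceMap c p hp ≫ B.tgt = B.prodInterval c := by
  rw [faceMap, pair_tgt_prodInterval _ _ ((constMap_tgt _ _).trans hp'), Category.assoc,
    B.ident_tgt, Category.comp_id]

theorem comp_faceMap (k : S ⟶ B.Mor) (s : S ⟶ T) (c : T ⟶ B.Ob) {p : T ⟶ B.Mor}
    (hp : p ≫ B.src = terminal.from T ≫ B.pt) (hk : k ≫ B.tgt = s ≫ c) :
    B.comp k (s ≫ B.faceMap c p hp) (by rw [Category.assoc, faceMap_src, hk]) =
      B.pair k (B.constMap (k ≫ B.src) (s ≫ p)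
        (by rw [Category.assoc, hp, terminal_from_natural])) (by rw [constMap_src]) := by
  refine (B.comp_congr rfl (B.pair_natural _ _ _ _) _).trans ((B.comp_pair _ _ _ _ ?_).trans
    (B.pair_congr ?_ ?_ _))
  · rw [hk, Category.assoc, Category.assoc, B.ident_src, Category.comp_id]
  · exact (B.comp_congr rfl (by rw [← Category.assoc, ← hk, Category.assoc]) _).trans
      (B.comp_ident k)
  · exact (B.comp_congr rfl (constMap_natural _ _ _) _).trans (comp_constMap _ _ _ hk)

/-- Transport along the interval in a fibration: an element of the fibre over one face of a cube
extends to the whole cube. -/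
theorem exists_transport (K : KanFibrations B) {X Y : B.CSet} {f : X ⟶ Y} (hf : K.fib f)
    (c : T ⟶ B.Ob) {p : T ⟶ B.Mor} (hp : p ≫ B.src = terminal.from T ≫ B.pt)
    (hp' : p ≫ B.tgt = terminal.from T ≫ B.interval) (y : T ⟶ Y.obj)
    (hy : y ≫ Y.proj = B.prodInterval c) (x : T ⟶ X.obj)
    (hx : x ≫ Hom.hom f = Y.act y (B.faceMap c p hp) (by rw [faceMap_tgt c hp hp', hy])) :
    ∃ x' : T ⟶ X.obj, x' ≫ Hom.hom f = y := by
  have hxc : x ≫ X.proj = c := by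
    rw [← hom_proj f, ← Category.assoc, hx, Y.act_proj, faceMap_src]
  -- By the Yoneda lemma `x` is a map `A ⟶ X`, and `y` is a map out of `y (c × I)`; composing the
  -- latter with pairing gives `b : y I × A ⟶ Y`.
  let A := family B.toInternalCategory c
  let b := B.pairMap c ≫ ofElement Y (B.prodInterval c) y hy
  have hb : ∀ {S : E} (z : S ⟶ (prod B.yI A).obj), z ≫ Hom.hom b =
      Y.act (((z ≫ Hom.hom (snd B.yI A)) ≫ familyParam c) ≫ y)
        (B.pair ((z ≫ Hom.hom (snd B.yI A)) ≫ familyMap c)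
          ((z ≫ Hom.hom (fst B.yI A)) ≫ familyMap B.interval)
          ((B.comp_snd_family_src z).trans (B.comp_fst_interval_src z).symm)) (by
        rw [pair_tgt_prodInterval _ _ (B.comp_fst_interval_tgt z), comp_familyMap_tgt,
          Category.assoc, hy, prodInterval_natural]) := by
    intro S z
    refine (Category.assoc _ _ _).symm.trans ((comp_ofElement _ _ _ _ _).trans ?_)
    exact Y.act_congr (by rw [comp_pairMap_param]) (B.comp_pairMap_map c z) _
  -- Restricting `b` to the copy of `A` at the point `p` is restricting `y` to its face, which is
  -- the image of `x` by `hx`.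
  have comm : ofElement X c x hxc ≫ f =
      lift (familyIndex c ≫ B.pointMap p hp hp') (𝟙 A) ≫ b := by
    apply hom_ext_of_comp
    intro S z
    have h₁ : (z ≫ Hom.hom (lift (familyIndex c ≫ B.pointMap p hp hp') (𝟙 A))) ≫
        Hom.hom (snd B.yI A) = z := by
      rw [Category.assoc, ← comp_hom, lift_snd, id_hom, Category.comp_id]
    have h₂ : (z ≫ Hom.hom (lift (familyIndex c ≫ B.pointMap p hp hp') (𝟙 A))) ≫
        Hom.hom (fst B.yI A) = (z ≫ Hom.hom (familyIndex c)) ≫ Hom.hom (B.pointMap p hp hp') := by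
      rw [Category.assoc, ← comp_hom, lift_fst, comp_hom, Category.assoc]
    have h₃ := (congrArg (· ≫ familyMap B.interval) h₂).trans (B.comp_pointMap p hp hp' _)
    have h₄ : ((z ≫ familyParam c) ≫ x) ≫ Hom.hom f = _ :=
      (Category.assoc _ _ _).trans ((congrArg _ hx).trans (Y.act_natural _ _ _ _))
    refine (Category.assoc _ _ _).symm.trans ((congrArg (· ≫ Hom.hom f)
      (comp_ofElement X c x hxc z)).trans ((act_hom _ _ _ _).trans
      ((Y.act_eq_act_comp h₄ _ _).trans ?_)))
    refine Eq.trans ?_ ((hb _).symm.trans (Category.assoc _ _ _))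
    refine Y.act_congr (by rw [h₁]) ((comp_faceMap _ _ _ _ (comp_familyMap_tgt z)).trans
      (B.pair_congr (by rw [h₁]) ((constMap_congr ?_ ?_ _).trans h₃.symm) _)) _
    · rw [comp_familyMap_src, Category.assoc, hom_proj]
    · rw [Category.assoc z (Hom.hom (familyIndex c)), familyIndex_val]
  -- The point `p` varies with the index in `T`, so the lifting property is needed with a parameter,
  -- for `A` lying over `Δ T`.
  have := K.hurewicz (familyIndex c) (B.pointMap p hp hp') f hf
  have sq : CommSq (ofElement X c x hxc) (lift (familyIndex c ≫ B.pointMap p hp hp') (𝟙 A)) f b :=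
    ⟨comm⟩
  -- The lift is evaluated at the generic element of `y I × A`, namely the two projections of `c ×
  -- I`; the image of this element under `b` is `y`.
  let d := Limits.prod.lift c (terminal.from T ≫ B.interval)
  have hd₁ : (d ≫ B.prodFst) ≫ B.tgt = 𝟙 T ≫ c := by
    rw [Category.assoc, B.prodFst_tgt, Limits.prod.lift_fst, Category.id_comp]
  have hd₂ : (d ≫ B.prodSnd) ≫ B.tgt = terminal.from T ≫ B.interval := by
    rw [Category.assoc, B.prodSnd_tgt, Limits.prod.lift_snd]
  let z₁ : T ⟶ B.yI.obj := familyMk B.interval (d ≫ B.prodSnd) _ hd₂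
  let z₂ : T ⟶ A.obj := familyMk c (d ≫ B.prodFst) (𝟙 T) hd₁
  let z : T ⟶ (prod B.yI A).obj := prodMk z₁ z₂ (by
    refine (familyMk_proj B.interval _ _ hd₂).trans (Eq.trans ?_ (familyMk_proj c _ _ hd₁).symm)
    rw [Category.assoc, Category.assoc, B.prodSnd_src, B.prodFst_src])
  have hz₁ : z ≫ Hom.hom (fst B.yI A) = z₁ := prodMk_fst _ _ _
  have hz₂ : z ≫ Hom.hom (snd B.yI A) = z₂ := prodMk_snd _ _ _
  refine ⟨z ≫ Hom.hom sq.lift, ?_⟩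
  rw [Category.assoc, ← comp_hom, sq.fac_right, hb]
  refine (Y.act_congr (x' := y) ?_ ((B.pair_congr ?_ ?_ _).trans
    (B.pair_fst_snd c (terminal.from T ≫ B.interval))) _).trans
    ((Y.act_congr rfl ?_ ?_).trans (Y.act_ident y))
  · rw [hz₂, familyMk_param, Category.id_comp]
  · rw [hz₂, familyMk_map]
  · rw [hz₁]
    exact familyMk_map B.interval _ _ hd₂
  · rw [← Category.assoc, hy, prodInterval]
  · rw [hy, Category.assoc, B.ident_tgt, Category.comp_id, prodInterval]

end CubeCategory

end Cubes

/-! ## Emptiness of the fibres of a fibration over a cube -/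

namespace CubeCategory

open Presheaf

section Vertex

variable {E : Type u} [Category.{v} E] [HasFiniteLimits E]

variable {ℕE : NaturalNumbersObject E} (B : CubeCategory ℕE) {S T : E}

variable {B} in
theorem faceMap_natural (s : S ⟶ T) (c : T ⟶ B.Ob) {p : T ⟶ B.Mor}
    (hp : p ≫ B.src = terminal.from T ≫ B.pt) :
    s ≫ B.faceMap c p hp = B.faceMap (s ≫ c) (s ≫ p)
      (by rw [Category.assoc, hp, terminal_from_natural]) :=
  (B.pair_natural _ _ _ _).trans
    (B.pair_congr (Category.assoc _ _ _).symm (constMap_natural _ _ _) _)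

theorem succ_pow (n : T ⟶ ℕE.N) : (n ≫ ℕE.succ) ≫ B.pow = B.prodInterval (n ≫ B.pow) := by
  rw [Category.assoc, B.pow_succ, ← Category.assoc, Limits.prod.comp_lift, terminal_from_natural,
    prodInterval]

theorem exists_interval_point : ∃ z : ⊤_ E ⟶ B.Mor, z ≫ B.src = B.pt ∧ z ≫ B.tgt = B.interval := by
  -- The endpoint `zero` is evaluated at the terminal cube.
  refine ⟨(constMk (𝟙 _) B.pt ≫ Hom.hom B.zero) ≫ familyMap B.interval, ?_, ?_⟩
  · refine (comp_familyMap_src _).trans ((Category.assoc _ _ _).trans ?_)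
    exact (congrArg _ (hom_proj B.zero)).trans (constMk_proj _ _)
  · refine (comp_familyMap_tgt _).trans ?_
    exact (congrArg (· ≫ B.interval) (Subsingleton.elim _ (𝟙 (⊤_ E)))).trans (Category.id_comp _)

/-- Each power of the interval has a point. -/
theorem exists_vertex : ∃ v : ℕE.N ⟶ B.Mor,
    v ≫ B.src = terminal.from _ ≫ B.pt ∧ v ≫ B.tgt = B.pow := by
  obtain ⟨z, hz, hz'⟩ := B.exists_interval_point
  have hp : (terminal.from B.Mor ≫ z) ≫ B.src = terminal.from B.Mor ≫ B.pt := by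
    rw [Category.assoc, hz]
  have hp' : (terminal.from B.Mor ≫ z) ≫ B.tgt = terminal.from B.Mor ≫ B.interval := by
    rw [Category.assoc, hz']
  -- The recursion step appends the coordinate `0` to a map of cubes.
  let s : B.Mor ⟶ B.Mor := B.pair (𝟙 _) (B.constMap B.src _ hp)
    (by rw [constMap_src, Category.id_comp])
  have hs : s ≫ B.src = B.src := by rw [B.pair_src, Category.id_comp]
  have hs' : s ≫ B.tgt = B.tgt ≫ B.prodInterval (𝟙 _) := by
    rw [pair_tgt_prodInterval _ _ ((constMap_tgt _ _).trans hp'), prodInterval_natural,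
      Category.id_comp, Category.comp_id]
  obtain ⟨r, ⟨h₀, h₁⟩, -⟩ := ℕE.existsUnique_rec (B.pt ≫ B.ident) s
  -- The source and the target of `r n` are identified by uniqueness of recursion: the source stays
  -- at the terminal cube, and the target gains a factor `I` at each step, as `pow` does.
  refine ⟨r, (ℕE.existsUnique_rec B.pt (𝟙 B.Ob)).unique ⟨?_, ?_⟩ ⟨?_, ?_⟩,
    (ℕE.existsUnique_rec B.pt (B.prodInterval (𝟙 B.Ob))).unique ⟨?_, ?_⟩ ⟨B.pow_zero, ?_⟩⟩
  · rw [reassoc_of% h₀, B.ident_src, Category.comp_id]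
  · rw [reassoc_of% h₁, hs, Category.comp_id]
  · rw [terminal_from_natural, Subsingleton.elim (terminal.from (⊤_ E)) (𝟙 _), Category.id_comp]
  · rw [terminal_from_natural, Category.comp_id]
  · rw [reassoc_of% h₀, B.ident_tgt, Category.comp_id]
  · rw [reassoc_of% h₁, hs', Category.assoc]
  · rw [prodInterval_natural, Category.comp_id]
    simpa only [Category.id_comp] using B.succ_pow (𝟙 _)

end Vertex

/-- A cube `y` of dimension `n` in `Y` such that the fibre of `f` over `y` is empty, while the fibre
over some vertex `p` of `y` is not. -/
structure EmptyCube {E : Type u} [Category.{v} E] [HasFiniteLimits E]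
    {ℕE : NaturalNumbersObject E} {B : CubeCategory ℕE} {X Y : B.CSet} (f : X ⟶ Y) {T : E}
    (n : T ⟶ ℕE.N) where
  cube : T ⟶ Y.obj
  cube_proj : cube ≫ Y.proj = n ≫ B.pow
  vertex : T ⟶ B.Mor
  vertex_src : vertex ≫ B.src = terminal.from T ≫ B.pt
  vertex_tgt : vertex ≫ B.tgt = n ≫ B.pow
  elt : T ⟶ X.obj
  elt_hom : elt ≫ Hom.hom f = Y.act cube vertex (cube_proj.trans vertex_tgt.symm)
  disjoint : DisjointOver (Hom.hom f) cube

/-! ### Induction on the dimension of a cube -/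

namespace EmptyCube

variable {E : Type u} [Category.{v} E] [HasFiniteLimits E]

variable {ℕE : NaturalNumbersObject E} {B : CubeCategory ℕE} {X Y : B.CSet} {f : X ⟶ Y} {S T : E}

/-- Reindexing of a family of cubes. -/
def precomp {n : T ⟶ ℕE.N} (w : EmptyCube f n) (s : S ⟶ T) : EmptyCube f (s ≫ n) where
  cube := s ≫ w.cube
  cube_proj := by rw [Category.assoc, w.cube_proj, Category.assoc]
  vertex := s ≫ w.vertex
  vertex_src := by rw [Category.assoc, w.vertex_src, terminal_from_natural]
  vertex_tgt := by rw [Category.assoc, w.vertex_tgt, Category.assoc]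
  elt := s ≫ w.elt
  elt_hom := by rw [Category.assoc, w.elt_hom, Y.act_natural]
  disjoint := w.disjoint.precomp s

/-- The only vertex of a cube of dimension zero is the identity, so `elt` lies in the fibre that is
supposed to be empty. -/
theorem vacuous_zero (w : EmptyCube f (terminal.from T ≫ ℕE.zero)) : Vacuous T := by
  refine w.disjoint w.elt (𝟙 T) ?_
  have h : w.vertex = w.cube ≫ Y.proj ≫ B.ident := by
    apply B.to_pt_ext
    · rw [w.vertex_src, reassoc_of% w.cube_proj, reassoc_of% B.pow_zero]
      simp only [Category.assoc, B.ident_src, Category.comp_id]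
    · rw [w.vertex_tgt, Category.assoc, B.pow_zero]
    · rw [reassoc_of% w.cube_proj, reassoc_of% B.pow_zero]
      simp only [Category.assoc, B.ident_tgt, Category.comp_id]
  rw [w.elt_hom, Category.id_comp]
  exact (Y.act_congr rfl h _).trans (Y.act_ident _)

/-- Split the vertex of `I^n × I` as a pair `(p₁, p₂)`. The face at `p₂` has `p₁` as a vertex with
an inhabited fibre, and its own fibre is empty because transport would extend an element over the
face to the whole cube. -/
theorem exists_pred (K : KanFibrations B) (hf : K.fib f) {n : T ⟶ ℕE.N}
    (w : EmptyCube f (n ≫ ℕE.succ)) : Nonempty (EmptyCube f n) := by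
  let c := n ≫ B.pow
  let d := Limits.prod.lift c (terminal.from T ≫ B.interval)
  have hpt : w.vertex ≫ B.tgt = B.prodInterval c := w.vertex_tgt.trans (B.succ_pow n)
  have hy : w.cube ≫ Y.proj = B.prodInterval c := w.cube_proj.trans (B.succ_pow n)
  have hd₁ : w.vertex ≫ B.tgt = (d ≫ B.prodFst) ≫ B.src := by
    rw [hpt, Category.assoc, B.prodFst_src, prodInterval]
  have hd₂ : w.vertex ≫ B.tgt = (d ≫ B.prodSnd) ≫ B.src := by
    rw [hpt, Category.assoc, B.prodSnd_src, prodInterval]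
  let p₁ := B.comp w.vertex (d ≫ B.prodFst) hd₁
  let p₂ := B.comp w.vertex (d ≫ B.prodSnd) hd₂
  have hp₁ : p₁ ≫ B.src = terminal.from T ≫ B.pt := (B.comp_src _ _ _).trans w.vertex_src
  have hp₂ : p₂ ≫ B.src = terminal.from T ≫ B.pt := (B.comp_src _ _ _).trans w.vertex_src
  have hp₁' : p₁ ≫ B.tgt = c := by
    rw [B.comp_tgt, Category.assoc, B.prodFst_tgt, Limits.prod.lift_fst]
  have hp₂' : p₂ ≫ B.tgt = terminal.from T ≫ B.interval := by
    rw [B.comp_tgt, Category.assoc, B.prodSnd_tgt, Limits.prod.lift_snd]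
  have hd : Limits.prod.lift (p₁ ≫ B.tgt) (p₂ ≫ B.tgt) = d := by rw [hp₁', hp₂']
  have hp : w.vertex = B.pair p₁ p₂ (hp₁.trans hp₂.symm) :=
    B.eq_pair _ ⟨by rw [hd, hd₁], B.comp_congr rfl (by rw [hd]) _⟩
      ⟨by rw [hd, hd₂], B.comp_congr rfl (by rw [hd]) _⟩
  let k := B.faceMap c p₂ hp₂
  have hk : w.cube ≫ Y.proj = k ≫ B.tgt := by rw [hy, faceMap_tgt c hp₂ hp₂']
  have hp₁k : p₁ ≫ B.tgt = k ≫ B.src := by rw [hp₁', faceMap_src]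
  -- The vertex `p₁` of the face is the given vertex of the cube, so `elt` can be kept.
  have hcomp : B.comp p₁ k hp₁k = w.vertex := by
    refine (B.comp_congr rfl (Category.id_comp k).symm _).trans ((comp_faceMap p₁ (𝟙 T) c hp₂
      (by rw [hp₁', Category.id_comp])).trans (Eq.trans (B.pair_congr rfl ?_ _) hp.symm))
    exact (constMap_congr (hp₁.trans hp₂.symm) (Category.id_comp _) _).trans (B.constMap_pt hp₂)
  refine ⟨⟨Y.act w.cube k hk, ?_, p₁, hp₁, hp₁', w.elt, ?_, ?_⟩⟩
  · rw [Y.act_proj, faceMap_src]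
  · exact w.elt_hom.trans ((Y.act_congr rfl hcomp.symm _).trans (Y.act_comp _ _ _ hp₁k hk).symm)
  · intro S x s hx
    have hps : (s ≫ p₂) ≫ B.src = terminal.from S ≫ B.pt := by
      rw [Category.assoc, hp₂, terminal_from_natural]
    obtain ⟨x', hx'⟩ := exists_transport K hf (s ≫ c) hps
      (by rw [Category.assoc, hp₂', terminal_from_natural]) (s ≫ w.cube)
      (by rw [Category.assoc, hy, prodInterval_natural]) x
      (hx.trans ((Y.act_natural _ _ _ _).trans (Y.act_congr rfl (faceMap_natural _ _ _) _)))
    exact w.disjoint x' s hx'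

/-- There is a universal family of cubes with a nonempty fibre at a vertex and an empty fibre. -/
theorem exists_universal [LocallyCartesianClosed E] [HasInitial E] (f : X ⟶ Y) :
    ∃ (W : E) (n : W ⟶ ℕE.N), Nonempty (EmptyCube f n) ∧
      ∀ {S : E} {n' : S ⟶ ℕE.N}, EmptyCube f n' → ∃ s : S ⟶ W, s ≫ n = n' := by
  -- The data are collected by finite limits: `M` holds the `y` with empty fibre, `V` adds a
  -- dimension `n` with `y` of shape `I^n`, `U` adds a map `p` into `I^n`, `R` requires its source
  -- to be terminal, and `W` adds an element of `X` over `y · p`.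
  obtain ⟨M, i, hi⟩ := exists_isPseudocomplement (Hom.hom f)
  let V := pullback (i ≫ Y.proj) B.pow
  let yV : V ⟶ Y.obj := pullback.fst _ _ ≫ i
  let nV : V ⟶ ℕE.N := pullback.snd _ _
  have hV : yV ≫ Y.proj = nV ≫ B.pow := by
    rw [Category.assoc]
    exact pullback.condition
  let U := pullback (nV ≫ B.pow) B.tgt
  let uV : U ⟶ V := pullback.fst _ _
  let pU : U ⟶ B.Mor := pullback.snd _ _
  have hU : uV ≫ nV ≫ B.pow = pU ≫ B.tgt := pullback.condition
  let R := equalizer (pU ≫ B.src) (terminal.from U ≫ B.pt)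
  let rU : R ⟶ U := equalizer.ι _ _
  have hR : rU ≫ pU ≫ B.src = rU ≫ terminal.from U ≫ B.pt := equalizer.condition _ _
  have ha : ((rU ≫ uV) ≫ yV) ≫ Y.proj = (rU ≫ pU) ≫ B.tgt := by
    simp only [Category.assoc, hV, hU]
  let a : R ⟶ Y.obj := Y.act ((rU ≫ uV) ≫ yV) (rU ≫ pU) ha
  let W := pullback a (Hom.hom f)
  let wR : W ⟶ R := pullback.fst _ _
  let xW : W ⟶ X.obj := pullback.snd _ _
  refine ⟨W, wR ≫ rU ≫ uV ≫ nV, ⟨wR ≫ rU ≫ uV ≫ yV, ?_, wR ≫ rU ≫ pU, ?_, ?_, xW, ?_, ?_⟩, ?_⟩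
  · simp only [Category.assoc, hV]
  · simp only [Category.assoc, hR, terminal_from_natural]
  · simp only [Category.assoc, hU]
  · refine pullback.condition.symm.trans ((Y.act_natural _ _ _ _).trans ?_)
    exact Y.act_congr (by simp only [Category.assoc, wR]) rfl _
  · have := hi.disjoint.precomp (wR ≫ rU ≫ uV ≫ pullback.fst _ _)
    simpa only [Category.assoc] using this
  · intro S n' w
    obtain ⟨t, ht⟩ := (hi.factors_iff w.cube).2 w.disjoint
    let sV : S ⟶ V := pullback.lift t n' (by rw [← Category.assoc, ht, w.cube_proj])
    have hsn : sV ≫ nV = n' := pullback.lift_snd _ _ _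
    have hsy : sV ≫ yV = w.cube := (pullback.lift_fst_assoc _ _ _ _).trans ht
    let sU : S ⟶ U := pullback.lift sV w.vertex (by rw [reassoc_of% hsn, w.vertex_tgt])
    have hsV : sU ≫ uV = sV := pullback.lift_fst _ _ _
    have hsp : sU ≫ pU = w.vertex := pullback.lift_snd _ _ _
    let sR : S ⟶ R := equalizer.lift sU (by
      rw [reassoc_of% hsp, w.vertex_src, terminal_from_natural])
    have hsU : sR ≫ rU = sU := equalizer.lift_ι _ _
    let sW : S ⟶ W := pullback.lift sR w.elt (by
      rw [w.elt_hom]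
      refine (Y.act_natural _ _ _ _).trans (Y.act_congr ?_ ?_ _)
      · simp only [Category.assoc, reassoc_of% hsU, reassoc_of% hsV, hsy]
      · rw [reassoc_of% hsU, hsp])
    have hsR : sW ≫ wR = sR := pullback.lift_fst _ _ _
    exact ⟨sW, by rw [reassoc_of% hsR, reassoc_of% hsU, reassoc_of% hsV, hsn]⟩

/-- Internal induction requires a single object over the natural numbers, and the universal family
`W` is one. Every other family is a reindexing of it along `s`, so it is empty if `W` is. -/
theorem vacuous [LocallyCartesianClosed E] [HasInitial E] (K : KanFibrations B) (hf : K.fib f)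
    {n : T ⟶ ℕE.N} (w : EmptyCube f n) : Vacuous T := by
  obtain ⟨W, m, ⟨u⟩, hW⟩ := exists_universal f
  obtain ⟨s, -⟩ := hW w
  refine .of_hom (ℕE.disjointOver_of_induction m ?_ ?_) s
  · intro S x t hx
    have := u.precomp x
    rw [hx, Subsingleton.elim t (terminal.from S)] at this
    exact this.vacuous_zero
  · intro A n hn S x t hx
    have v := u.precomp x
    rw [hx, ← Category.assoc] at v
    obtain ⟨v'⟩ := v.exists_pred K hf
    -- The family of dimension `n` just obtained factors through `W`, so the induction hypothesis
    -- applies to it.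
    obtain ⟨r, hr⟩ := hW v'
    exact hn r t hr

end EmptyCube

/-! ### From powers of the interval to arbitrary cubes -/

variable {E : Type u} [Category.{v} E] [Regular E] {ℕE : NaturalNumbersObject E}

variable {B : CubeCategory ℕE} {T : E}

/-- Each family of cubes is locally isomorphic to a family of powers of the interval. -/
theorem exists_cover (c : T ⟶ B.Ob) : ∃ (P : E) (π : P ⟶ T) (n : P ⟶ ℕE.N) (i j : P ⟶ B.Mor),
    IsRegularEpi π ∧ i ≫ B.src = π ≫ c ∧ i ≫ B.tgt = n ≫ B.pow ∧
      j ≫ B.src = n ≫ B.pow ∧ j ≫ B.tgt = π ≫ c ∧ B.IsComp i j (π ≫ c ≫ B.ident) := by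
  obtain ⟨T₀, e, n, i, j, he, hi, hi', ⟨h, hij⟩, ⟨h', -⟩⟩ := B.exists_pow
  -- The cover in `exists_pow` is pulled back along `c`; regular epimorphisms are stable under
  -- pullback in a regular category.
  refine ⟨pullback c e, pullback.fst c e, pullback.snd c e ≫ n, pullback.snd c e ≫ i,
    pullback.snd c e ≫ j, inferInstance, ?_, ?_, ?_, ?_, ?_⟩
  · rw [Category.assoc, hi, pullback.condition]
  · rw [Category.assoc, hi', Category.assoc]
  · rw [Category.assoc, ← h, hi', Category.assoc]
  · rw [Category.assoc, h', hi, pullback.condition]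
  · refine ⟨by simp only [Category.assoc, h], ?_⟩
    rw [← B.comp_natural _ _ _ h, hij, pullback.condition_assoc]

/-- Each family of cubes locally has a point. -/
theorem exists_cover_point (c : T ⟶ B.Ob) : ∃ (P : E) (π : P ⟶ T) (p : P ⟶ B.Mor),
    IsRegularEpi π ∧ p ≫ B.src = terminal.from P ≫ B.pt ∧ p ≫ B.tgt = π ≫ c := by
  obtain ⟨P, π, n, i, j, hπ, -, -, hj, hj', -⟩ := exists_cover c
  obtain ⟨v, hv, hv'⟩ := B.exists_vertex
  have h : (n ≫ v) ≫ B.tgt = j ≫ B.src := by rw [Category.assoc, hv', hj]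
  exact ⟨P, π, B.comp (n ≫ v) j h, hπ,
    by rw [B.comp_src, Category.assoc, hv, terminal_from_natural], by rw [B.comp_tgt, hj']⟩

variable [LocallyCartesianClosed E] [HasInitial E] {X Y : B.CSet} {f : X ⟶ Y}

/-- On a cover the cube is isomorphic to some `I^n`. Moving `y` and `p` across the isomorphism gives
an `EmptyCube`, and emptiness of the cover descends to `T`. -/
theorem vacuous_of_point (K : KanFibrations B) (hf : K.fib f) {y : T ⟶ Y.obj} {p : T ⟶ B.Mor}
    (hp : p ≫ B.src = terminal.from T ≫ B.pt) (h : y ≫ Y.proj = p ≫ B.tgt) {x : T ⟶ X.obj}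
    (hx : x ≫ Hom.hom f = Y.act y p h) (hd : DisjointOver (Hom.hom f) y) : Vacuous T := by
  obtain ⟨P, π, n, i, j, hπ, hi, hi', hj, hj', hij, hijc⟩ := exists_cover (y ≫ Y.proj)
  have h₁ : (π ≫ y) ≫ Y.proj = j ≫ B.tgt := by rw [Category.assoc, hj']
  have h₂ : (π ≫ p) ≫ B.tgt = i ≫ B.src := by rw [Category.assoc, hi, h]
  have hc : B.comp (B.comp (π ≫ p) i h₂) j (by rw [B.comp_tgt, hij]) = π ≫ p :=
    (B.assoc _ _ _ h₂ hij).trans ((B.comp_congr rfl (hijc.trans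
      (by rw [h]; simp only [Category.assoc])) _).trans (B.comp_ident (π ≫ p)))
  have hji : Y.act (Y.act (π ≫ y) j h₁) i (by rw [Y.act_proj, hij]) = π ≫ y :=
    (Y.act_comp _ _ _ hij h₁).trans ((Y.act_congr rfl (hijc.trans (by simp only [Category.assoc]))
      _).trans (Y.act_ident (π ≫ y)))
  refine Vacuous.of_isRegularEpi (EmptyCube.vacuous (f := f) K hf (n := n)
    ⟨Y.act (π ≫ y) j h₁, ?_, B.comp (π ≫ p) i h₂, ?_, ?_, π ≫ x, ?_, ?_⟩) π
  · rw [Y.act_proj, hj]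
  · rw [B.comp_src, Category.assoc, hp, terminal_from_natural]
  · rw [B.comp_tgt, hi']
  · rw [Category.assoc, hx, Y.act_natural]
    exact (Y.act_congr rfl hc.symm _).trans (Y.act_comp _ _ _ _ h₁).symm
  -- Restricting the moved cube back along `i` recovers `y`, whose fibre is empty.
  · apply disjointOver_of_act f (g := i)
    rw [hji]
    exact hd.precomp π

/-- In a fibration, the fibres over the restrictions of an element with empty fibre are empty. -/
theorem restrictsEmptiness_of_fib (K : KanFibrations B) (hf : K.fib f) : RestrictsEmptiness f := by
  intro T y g h hd S x s hx
  -- After a cover, choose a point `p` of the source of `g`. Restricting `x` along `p` gives an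
  -- element over `(y · g) · p`, which is a vertex of `y`.
  obtain ⟨P, π, p, hπ, hp, hp'⟩ := exists_cover_point (s ≫ g ≫ B.src)
  rw [Y.act_natural] at hx
  have hpg : p ≫ B.tgt = (π ≫ s ≫ g) ≫ B.src := by simpa only [Category.assoc] using hp'
  have hy : (π ≫ s ≫ y) ≫ Y.proj = (π ≫ s ≫ g) ≫ B.tgt := by simp only [Category.assoc, h]
  have hxp : (π ≫ x) ≫ X.proj = p ≫ B.tgt := by
    rw [← hom_proj f, Category.assoc, reassoc_of% hx, Y.act_proj, hp', Category.assoc]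
  refine Vacuous.of_isRegularEpi (vacuous_of_point K hf (y := π ≫ s ≫ y)
    (p := B.comp p (π ≫ s ≫ g) hpg) ?_ ?_ (x := X.act (π ≫ x) p hxp) ?_
    ((hd.precomp s).precomp π)) π
  · rw [B.comp_src, hp]
  · rw [B.comp_tgt, hy]
  · rw [act_hom, ← Y.act_comp _ _ _ hpg hy]
    exact Y.act_congr (by rw [Category.assoc, hx, Y.act_natural]) rfl _

end CubeCategory

/-! ## The classifier of `¬¬`-stable homotopy propositions -/

theorem mono_of_isPullback {C : Type u} [Category.{v} C] {P X Y Z : C} {p : P ⟶ X} {q : P ⟶ Y}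
    {f : X ⟶ Z} {g : Y ⟶ Z} (h : IsPullback p q f g) [Mono f] : Mono q :=
  (MorphismProperty.monomorphisms C).of_isPullback h (.infer_property f)

/-! ### Constant presheaves and negation -/

namespace Presheaf

variable {E : Type u} [Category.{v} E] [HasFiniteLimits E] {C : InternalCategory E}

/-- Objectwise `Δ u` is the product of `u` with the object of cubes, hence a base change of `u`.
Monicity of `u` passes to `Δ u` this way, and pullbacks of `Δ m` become pullbacks of `m` by pasting.
-/
theorem isPullback_constVal {S T : E} (u : S ⟶ T) :
    IsPullback (constVal C S) (Hom.hom ((const C).map u)) u (constVal C T) := by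
  refine ⟨⟨(const_map_val u).symm⟩, ⟨PullbackCone.IsLimit.mk _
    (fun s => constMk s.fst (s.snd ≫ ((const C).obj T).proj)) (fun s => constMk_val _ _)
    (fun s => const_ext ?_ ?_) (fun s m h₁ h₂ => const_ext ?_ ?_)⟩⟩
  · rw [Category.assoc, const_map_val, ← Category.assoc, constMk_val, s.condition]
  · rw [Category.assoc, hom_proj, constMk_proj]
  · rw [h₁, constMk_val]
  · rw [constMk_proj, ← h₂, Category.assoc, hom_proj]

/-- Disjointness from `Δ f` depends only on the component in `Y`, where it is disjointness from `f`.
-/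
theorem isPseudocomplement_const {X Y N : E} {f : X ⟶ Y} {n : N ⟶ Y}
    (h : IsPseudocomplement f n) :
    IsPseudocomplement (Hom.hom ((const C).map f)) (Hom.hom ((const C).map n)) where
  mono := by
    have := h.mono
    exact mono_of_isPullback (isPullback_constVal (C := C) n)
  factors_iff a := by
    have hd : DisjointOver (Hom.hom ((const C).map f)) a ↔ DisjointOver f (a ≫ constVal C Y) :=
      ⟨fun hd _ x s hs => hd ((isPullback_constVal f).lift x (s ≫ a) (by rw [hs, Category.assoc]))
          s ((isPullback_constVal f).lift_snd _ _ _),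
        fun hd _ x s hs => hd (x ≫ constVal C X) s (by
          rw [Category.assoc, ← const_map_val, reassoc_of% hs])⟩
    rw [hd, ← h.factors_iff]
    exact ⟨fun ⟨t, ht⟩ =>
        ⟨t ≫ constVal C N, by rw [Category.assoc, ← const_map_val, reassoc_of% ht]⟩,
      fun ⟨t, ht⟩ => ⟨(isPullback_constVal n).lift t a ht, (isPullback_constVal n).lift_snd _ _ _⟩⟩

theorem negNegStable_const [HasInitial E] [HasStrictInitialObjects E] {X Y : E} {f : X ⟶ Y}
    (h : NegNegStable f) : NegNegStable ((const C).map f) := by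
  obtain ⟨N, M, n, k, hn, hk, s, hs⟩ := h
  refine ⟨_, _, (const C).map n, (const C).map k, ?_, ?_, (const C).map s, ?_⟩
  · exact (isPseudocomplement_of_hom (isPseudocomplement_const hn.isPseudocomplement)).isNegation
  · exact (isPseudocomplement_of_hom (isPseudocomplement_const hk.isPseudocomplement)).isNegation
  · rw [← Functor.map_comp, hs]

end Presheaf

/-! ### Homotopy equivalence and uniqueness of classifying maps -/

namespace CubeCategory

open Presheaf

section Homotopy

variable {E : Type u} [Category.{v} E] [HasFiniteLimits E] {ℕE : NaturalNumbersObject E}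
  {B : CubeCategory ℕE}

theorem isHomotopy_const {A X : B.CSet} (a : A ⟶ X) : IsHomotopy a a (snd B.yI A ≫ a) := by
  constructor <;> rw [← Category.assoc, lift_snd, Category.id_comp]

theorem pathSection_of_mono {X Y : B.CSet} (f : X ⟶ Y) [Mono f] : PathSection f := by
  intro A a b h
  obtain rfl := (cancel_mono f).1 h
  exact ⟨_, isHomotopy_const a, Category.assoc _ _ _⟩

/-- Logically equivalent homotopy propositions are equivalent. -/
theorem PathSection.fibrewiseEquivalent {X X' Y : B.CSet} {f : X ⟶ Y} {g : X' ⟶ Y}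
    (hf : PathSection f) (hg : PathSection g) {u : X ⟶ X'} {w : X' ⟶ X} (hu : u ≫ g = f)
    (hw : w ≫ f = g) : FibrewiseEquivalent f g :=
  ⟨u, w, hu, hw, hf _ _ (by rw [Category.assoc, hw, hu, Category.id_comp]),
    hg _ _ (by rw [Category.assoc, hu, hw, Category.id_comp])⟩

end Homotopy

variable {E : Type u} [Category.{v} E] [HasFiniteLimits E] {ℕE : NaturalNumbersObject E}
  {B : CubeCategory ℕE}

/-- A map to `Δ P` is determined by the homotopy pullback of an extensional monomorphism along
it. -/
theorem eq_of_isHomotopyPullback {P Q : E} {m : Q ⟶ P} (hm : Extensional m) {X Y : B.CSet}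
    {f : X ⟶ Y} {χ χ' : Y ⟶ B.Δ.obj P} (h : IsHomotopyPullback f (B.Δ.map m) χ)
    (h' : IsHomotopyPullback f (B.Δ.map m) χ') : χ = χ' := by
  obtain ⟨X₁, f₁, t₁, h₁, u₁, w₁, hu₁, hw₁, -, -⟩ := h
  obtain ⟨X₂, f₂, t₂, h₂, u₂, w₂, hu₂, hw₂, -, -⟩ := h'
  have p₁ := (isPullback_hom h₁).paste_horiz (isPullback_constVal m)
  have p₂ := (isPullback_hom h₂).paste_horiz (isPullback_constVal m)
  have := hm.1
  have m₁ : Mono (Hom.hom f₁) := mono_of_isPullback p₁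
  have m₂ : Mono (Hom.hom f₂) := mono_of_isPullback p₂
  -- The two pullbacks factor through each other by way of `f`; being monomorphisms into `Y`, they
  -- are the same subobject.
  have e₁ : (w₁ ≫ u₂) ≫ f₂ = f₁ := by rw [Category.assoc, hu₂, hw₁]
  have e₂ : (w₂ ≫ u₁) ≫ f₁ = f₂ := by rw [Category.assoc, hu₁, hw₂]
  have := mono_of_mono_hom f₁
  have := mono_of_mono_hom f₂
  let e : X₁ ≅ X₂ := ⟨w₁ ≫ u₂, w₂ ≫ u₁,
    by rw [← cancel_mono f₁, Category.assoc, e₂, e₁, Category.id_comp],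
    by rw [← cancel_mono f₂, Category.assoc, e₁, e₂, Category.id_comp]⟩
  apply hom_toConst_ext
  refine hm.2 (Hom.hom f₁) m₁ _ _ ⟨_, p₁⟩ ⟨_, (isPullback_hom
    (IsPullback.of_iso h₂ e.symm (Iso.refl _) (Iso.refl _) (Iso.refl _) (fst' := e.hom ≫ t₂)
      (snd' := f₁) (f' := B.Δ.map m) (g' := χ') ?_ ?_ ?_ ?_)).paste_horiz (isPullback_constVal m)⟩
  · simp
  · exact (Category.comp_id _).trans e₂.symm
  · simp
  · simp

end CubeCategory

/-! ### Existence of classifying maps -/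

namespace KanFibrations

open Presheaf CubeCategory

variable {E : Type u} [Category.{v} E] [Regular E] [LocallyCartesianClosed E] [HasInitial E]
  {ℕE : NaturalNumbersObject E} {B : CubeCategory ℕE} (K : KanFibrations B)

theorem negNegStableHProp_const {P Q : E} {m : Q ⟶ P} (hm : NegNegStableProp m) :
    K.NegNegStableHProp (B.Δ.map m) := by
  have := hm.1
  have : Mono (Hom.hom (B.Δ.map m)) := mono_of_isPullback (isPullback_constVal m)
  have := mono_of_mono_hom (B.Δ.map m)
  exact ⟨⟨K.const m, pathSection_of_mono _⟩, negNegStable_const hm.2⟩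

theorem exists_classifyingMap {P Q : E} {m : Q ⟶ P} (hm : IsClassifier NegNegStableProp m)
    {X Y : B.CSet} {f : X ⟶ Y} (hf : K.NegNegStableHProp f) :
    ∃ χ : Y ⟶ B.Δ.obj P, IsHomotopyPullback f (B.Δ.map m) χ := by
  obtain ⟨⟨hfib, hpath⟩, N, M, n, k, hn, hk, s, hs⟩ := hf
  replace hn := hn.isPseudocomplement
  replace hk := hk.isPseudocomplement
  have hn' := (restrictsEmptiness_of_fib K hfib).isPseudocomplement_hom hn
  have hnr := restrictsEmptiness_of_isPseudocomplement_hom hn'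
  have hk' := hnr.isPseudocomplement_hom hk
  have hkr := restrictsEmptiness_of_isPseudocomplement_hom hk'
  have := hk.mono
  have := hk'.mono
  -- Two further negations in `E` express that the underlying map of `¬¬f`, itself a negation, is
  -- `¬¬`-stable.
  obtain ⟨N₃, n₃, h₃⟩ := exists_isPseudocomplement (Hom.hom k)
  obtain ⟨N₄, n₄, h₄⟩ := exists_isPseudocomplement n₃
  obtain ⟨χ, t, hχ⟩ := (hm.2 (Hom.hom k)).1 ⟨hk'.mono, hk'.negNegStable h₃ h₄⟩
  -- `χ` descends to the constant presheaf because `y` and `y · g` pull `¬¬f` back to the same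
  -- subobject of `S`; extensionality of `m` then equates their classifying maps.
  have hinv : ∀ {S : E} (y : S ⟶ Y.obj) (g : S ⟶ B.Mor) (h : y ≫ Y.proj = g ≫ B.tgt),
      Y.act y g h ≫ χ = y ≫ χ := by
    intro S y g h
    have p₁ := IsPullback.of_hasPullback (Hom.hom k) (Y.act y g h)
    have hfac : ∀ {R : E} (r : R ⟶ S), (∃ z : R ⟶ M.obj, z ≫ Hom.hom k = r ≫ y) ↔
        ∃ z : R ⟶ M.obj, z ≫ Hom.hom k = r ≫ Y.act y g h := by
      intro R r
      have hrg : (r ≫ y) ≫ Y.proj = (r ≫ g) ≫ B.tgt := by simp only [Category.assoc, h]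
      rw [hk'.factors_iff, hk'.factors_iff, Y.act_natural _ _ _ h]
      exact ⟨hnr _ _ hrg, disjointOver_of_act n⟩
    have p₂ : ∃ z, IsPullback z (pullback.snd (Hom.hom k) (Y.act y g h)) (Hom.hom k) y := by
      obtain ⟨z, hz⟩ := (hfac (pullback.snd (Hom.hom k) (Y.act y g h))).2 ⟨_, p₁.w⟩
      have : Mono (pullback.snd (Hom.hom k) (Y.act y g h)) := inferInstance
      refine ⟨z, ⟨⟨hz⟩, ⟨PullbackCone.IsLimit.mk _ (fun c => p₁.lift _ c.snd
        ((hfac c.snd).1 ⟨c.fst, c.condition⟩).choose_spec) (fun c => ?_) (fun c => ?_)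
        (fun c j _ hj => ?_)⟩⟩⟩
      · rw [← cancel_mono (Hom.hom k), Category.assoc, hz, c.condition, ← Category.assoc,
          p₁.lift_snd]
      · exact p₁.lift_snd _ _ _
      · rw [← cancel_mono (pullback.snd (Hom.hom k) (Y.act y g h)), p₁.lift_snd, hj]
    obtain ⟨z, p₂⟩ := p₂
    exact hm.1.2 (pullback.snd (Hom.hom k) (Y.act y g h)) inferInstance _ _
      ⟨_, p₁.paste_horiz hχ⟩ ⟨_, p₂.paste_horiz hχ⟩
  let χ' : Y ⟶ B.Δ.obj P := Y.toConst χ hinv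
  have hχ' : Hom.hom χ' ≫ constVal _ P = χ := toConst_val _ _ _
  have := hm.1.1
  let t' : M ⟶ B.Δ.obj Q := M.toConst t fun x g h => by
    rw [← cancel_mono m, Category.assoc, Category.assoc, hχ.w, ← Category.assoc, act_hom, hinv,
      Category.assoc]
  have ht' : Hom.hom t' ≫ constVal _ Q = t := toConst_val _ _ _
  have hw : t' ≫ B.Δ.map m = k ≫ χ' := by
    apply hom_toConst_ext
    rw [comp_hom, comp_hom, Category.assoc, Category.assoc, const_map_val, reassoc_of% ht', hχ',
      hχ.w]
  have hp : IsPullback (Hom.hom t' ≫ constVal _ Q) (Hom.hom k) m (Hom.hom χ' ≫ constVal _ P) := by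
    rwa [ht', hχ']
  -- The unit `u` and the stability map `s` go between `f` and `¬¬f`; the path conditions turn this
  -- logical equivalence into a homotopy equivalence.
  obtain ⟨u, hu⟩ := hn.exists_unit hk
  exact ⟨χ', M, k, t',
    isPullback_of_hom (hp.of_right (congrArg Hom.hom hw) (isPullback_constVal m)),
    hpath.fibrewiseEquivalent (pathSection_of_mono k) hu hs⟩

end KanFibrations

end CubicalModel

end

theorem mainTheorem1 {E : Type u} [Category.{v} E] [Regular E]
    [CubicalModel.LocallyCartesianClosed E] [HasInitial E]
    (ℕE : CubicalModel.NaturalNumbersObject E) (B : CubicalModel.CubeCategory ℕE)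
    (K : CubicalModel.KanFibrations B) {Ω : E} (m : ⊤_ E ⟶ Ω)
    (hm : CubicalModel.IsClassifier CubicalModel.NegNegStableProp m) :
    CubicalModel.CubeCategory.IsHomotopyClassifier K.NegNegStableHProp (B.Δ.map m) := by
  -- `m` is a pullback of itself along the identity, hence a `¬¬`-stable proposition of `E`.
  refine ⟨K.negNegStableHProp_const ((hm.2 m).2 ⟨𝟙 _, 𝟙 _, .of_id_fst⟩), fun f hf =>
    ⟨K.exists_classifyingMap hm hf, fun χ χ' h h' => ?_⟩⟩
  obtain rfl := CubicalModel.CubeCategory.eq_of_isHomotopyPullback hm.1 h h'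
  exact ⟨_, CubicalModel.CubeCategory.isHomotopy_const χ⟩
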